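/- A (deterministic, leveled) $D$-way branching program $P$ on inputs $x\in D^n$ has layers $L_0,\dots,L_T$ of nodes, where $L_0$ contains only the root; each node in a layer $L_t$ with $t<T$ is labeled with an index $i\in[n]$ and has, for each $a\in D$, one outgoing edge to a node of $L_{t+1}$, which is followed if $x_i=a$; the nodes of $L_T$ are labeled with the Boolean output. Its time is $T(P)=T$ and its cumulative memory is $CM(P)=\sum_{t=0}^{T}\log_2|L_t|$. Let $ED_{n,N}:[N]^n\to\{0,1\}$ be the function that is $1$ iff all $n$ input values are distinct. **Theorem.** There is an absolute constant $C>0$ such that the following holds for every function $T:\mathbb N\to\mathbb N$ with $T(n)=o\bigl(n\sqrt{\log n/\log\log n}\bigr)$. There is a sequence $\delta(n)\to 0$ such that, for all sufficiently large $n$, every $[n^2]$-way branching program $P$ that computes $ED_{n,n^2}$ in time $\tau=T(P)\le T(n)$ satisfies $$CM(P)\ \ge\ \frac{n^2}{\max(\tau/n,\,2)^{\,C\tau^2/n^2}}\ \ge\ n^{2-\delta(n)}.$$ That is, time $T=o(n\sqrt{\log n/\log\log n})$ requires cumulative memory $n^2/(T/n)^{O(T^2/n^2)}$, which is $n^{2-o(1)}$.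 -/

import Mathlib

/-- A (deterministic, leveled) `D`-way branching program on inputs `x ∈ D^n` with Boolean output.
It has layers `0, 1, …, time`; the nodes of layer `t` are indexed by `Fin (width t)`; layer `0`
consists of the root; every node of a layer before the last one is labeled with the index of the
input coordinate that it queries and has, for every `a : D`, one outgoing edge, to the next layer.
The sinks, that is, the nodes of the last layer, are labeled with the output. -/
structure BranchingProgram (D : Type*) (n : ℕ) where
  /-- the length of the program -/
  time : ℕ
  /-- the number `|L_t|` of nodes of layer `t` -/
  width : Fin (time + 1) → ℕ
  width_zero : width 0 = 1
  /-- the coordinate queried at a node of layer `t < time` -/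
  query : ∀ t : Fin time, Fin (width t.castSucc) → Fin n
  /-- the end point of the edge labeled with a given value that leaves a given node -/
  next : ∀ t : Fin time, Fin (width t.castSucc) → D → Fin (width t.succ)
  /-- the output at the sinks -/
  sinkLabel : Fin (width (Fin.last time)) → Bool

namespace BranchingProgram

variable {D : Type*} {n : ℕ}

/-- The root, the only node of layer `0`. -/
def root (P : BranchingProgram D n) : Fin (P.width 0) :=
  ⟨0, by rw [P.width_zero]; exact Nat.one_pos⟩

/-- The node of layer `t` that the computation on input `x` visits. -/
def nodeAt (P : BranchingProgram D n) (x : Fin n → D) : ∀ t : Fin (P.time + 1), Fin (P.width t) :=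
  Fin.induction P.root (fun t v => P.next t v (x (P.query t v)))

/-- The output of the program on input `x`. -/
def output (P : BranchingProgram D n) (x : Fin n → D) : Bool :=
  P.sinkLabel (P.nodeAt x (Fin.last P.time))

/-- The program computes `f` (on every input, without error). -/
def Computes (P : BranchingProgram D n) (f : (Fin n → D) → Bool) : Prop :=
  ∀ x, P.output x = f x

/-- The cumulative memory `∑ t, log₂ |L_t|`, over all layers `t = 0, …, time`. -/
noncomputable def cumulativeMemory (P : BranchingProgram D n) : ℝ :=
  ∑ t : Fin (P.time + 1), Real.logb 2 (P.width t)

end BranchingProgram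

/-- Element Distinctness `ED_{n,N} : [N]^n → {0,1}`, which is `1` iff all values are distinct. -/
def elementDistinctness (n N : ℕ) (x : Fin n → Fin N) : Bool :=
  decide (Function.Injective x)

/-- The lower bound `n² / (τ/n)^(C τ²/n²)` for programs of time `τ` on `n` inputs, where the base
`τ/n` is read as `2` when `τ < 2 n`. -/
noncomputable def edBound (C : ℝ) (n τ : ℕ) : ℝ :=
  (n : ℝ) ^ 2 / (max ((τ : ℝ) / n) 2) ^ (C * ((τ : ℝ) ^ 2 / (n : ℝ) ^ 2))

/-!
Cut time into segments of length `h`, starting from a random offset. On average the layers at the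
segment boundaries carry a fraction `1 / h` of the cumulative memory, so it suffices to show that
for every offset the program has at least `2 ^ (μ / 4)` sequences of boundary nodes, where `μ` is
a `Q ^ O(k²)`-th fraction of `n` and `k` bounds `τ / n`.

Fix the boundary nodes and colour the segments at random. The coordinates read only in segments of
colour `a` and those read only in segments of colour `b` are the two feet of an embedded rectangle
on which the program accepts: mixing two computations with the same boundary nodes yields another
accepted, hence injective, input. So the values taken on the two feet are disjoint, one foot uses at
most half of the alphabet, and this costs a factor exponential in the size of the foot.

The feet depend on the input, but the rectangles must partition the inputs. Coordinates read in
exactly `l` segments are singled out by choosing the number of colours as a power of `Q` for which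
this level `l` dominates all others; then the foot of colour `a` is, up to a small deviation set,
visible from the computation outside the segments of colour `b`, and the few possible deviation sets
can be enumerated. Since a fraction at least `1 / n` of all inputs is injective, this forces the
number of boundary sequences to be large. Here `Q` is polynomial in `max (τ / n) 2`.
-/

section Rectangles

open Finset

theorem card_mul_le_card_of_eq_or_disjoint {β γ : Type*} [Fintype β] [DecidableEq β]
    {E : Finset γ} {Q : γ → Finset β} {c : ℕ}
    (hQ : ∀ x ∈ E, ∀ y ∈ E, Q x = Q y ∨ Disjoint (Q x) (Q y))
    (hc : ∀ x ∈ E, #{y ∈ E | Q y = Q x} * c ≤ #(Q x)) : #E * c ≤ Fintype.card β := by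
  have hdisj : (E.image Q : Set (Finset β)).PairwiseDisjoint id := by
    simp only [Set.PairwiseDisjoint, Set.Pairwise, mem_coe, mem_image]
    rintro _ ⟨x, hx, rfl⟩ _ ⟨y, hy, rfl⟩ hne
    exact (hQ x hx y hy).resolve_left hne
  calc #E * c = ∑ q ∈ E.image Q, #{y ∈ E | Q y = q} * c := by
        rw [card_eq_sum_card_image Q E, sum_mul]
    _ ≤ ∑ q ∈ E.image Q, #q := by
        refine sum_le_sum fun q hq => ?_
        obtain ⟨x, hx, rfl⟩ := mem_image.1 hq
        exact hc x hx
    _ = #((E.image Q).biUnion id) := (card_biUnion hdisj).symm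
    _ ≤ Fintype.card β := card_le_univ _

variable {ι α : Type*} [Fintype ι] [DecidableEq ι]

/-- The box of all functions that agree with `x` off `S` and take values in `V` on `S`. -/
def subbox (x : ι → α) (S : Finset ι) (V : Finset α) : Finset (ι → α) :=
  Fintype.piFinset fun j => if j ∈ S then V else {x j}

theorem mem_subbox {x y : ι → α} {S : Finset ι} {V : Finset α} :
    y ∈ subbox x S V ↔ (∀ j ∈ S, y j ∈ V) ∧ ∀ j ∉ S, y j = x j := by
  simp only [subbox, Fintype.mem_piFinset, ← forall_and]
  refine forall_congr' fun j => ?_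
  by_cases hj : j ∈ S <;> simp [hj]

theorem card_subbox (x : ι → α) (S : Finset ι) (V : Finset α) : #(subbox x S V) = #V ^ #S := by
  simp only [subbox, Fintype.card_piFinset, apply_ite card, card_singleton, prod_ite_mem,
    univ_inter, prod_const]

theorem mem_subbox_univ [Fintype α] {x y : ι → α} {S : Finset ι} :
    y ∈ subbox x S univ ↔ ∀ j ∉ S, y j = x j := by
  simp [mem_subbox]

theorem self_mem_subbox_univ [Fintype α] (x : ι → α) (S : Finset ι) : x ∈ subbox x S univ :=
  mem_subbox_univ.2 fun _ _ => rfl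

theorem subbox_univ_congr [Fintype α] {x y : ι → α} {S : Finset ι} (h : ∀ j ∉ S, x j = y j) :
    subbox x S univ = subbox y S univ := by
  ext z
  simp only [mem_subbox_univ]
  exact forall₂_congr fun j hj => by rw [h j hj]

/-- The hypothesis on `F` makes the boxes `subbox x (F x) univ` pairwise equal or disjoint. -/
theorem card_mul_two_pow_le_of_forall_mem [Fintype α] {E : Finset (ι → α)}
    {F : (ι → α) → Finset ι} {V : (ι → α) → Finset α} {f : ℕ}
    (hF : ∀ x ∈ E, ∀ y ∈ E, (∀ j, j ∉ F x → j ∉ F y → x j = y j) → F x = F y)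
    (hV : ∀ x ∈ E, ∀ y ∈ E, F x = F y → (∀ j ∉ F x, x j = y j) → ∀ j ∈ F x, y j ∈ V x)
    (hVcard : ∀ x ∈ E, 2 * #(V x) ≤ Fintype.card α) (hf : ∀ x ∈ E, f ≤ #(F x)) :
    #E * 2 ^ f ≤ Fintype.card (ι → α) := by
  classical
  have agree_of_mem : ∀ x ∈ E, ∀ y ∈ E, ∀ z ∈ subbox x (F x) univ, z ∈ subbox y (F y) univ →
      F x = F y ∧ ∀ j ∉ F x, x j = y j := by
    intro x hx y hy z hzx hzy
    rw [mem_subbox_univ] at hzx hzy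
    have hxy := hF x hx y hy fun j hjx hjy => (hzx j hjx).symm.trans (hzy j hjy)
    exact ⟨hxy, fun j hj => (hzx j hj).symm.trans (hzy j (hxy ▸ hj))⟩
  refine card_mul_le_card_of_eq_or_disjoint (Q := fun x => subbox x (F x) univ) ?_ ?_
  · refine fun x hx y hy => or_iff_not_imp_right.2 fun hxy => ?_
    obtain ⟨z, hzx, hzy⟩ := not_disjoint_iff.1 hxy
    obtain ⟨hFxy, hagree⟩ := agree_of_mem x hx y hy z hzx hzy
    exact (subbox_univ_congr hagree).trans (by rw [hFxy])
  · intro x hx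
    have hclass : {y ∈ E | subbox y (F y) univ = subbox x (F x) univ} ⊆
        subbox x (F x) (V x) := by
      intro y hy
      obtain ⟨hyE, hyx⟩ := mem_filter.1 hy
      obtain ⟨hFxy, hagree⟩ := agree_of_mem x hx y hyE y (hyx ▸ self_mem_subbox_univ y (F y))
        (self_mem_subbox_univ y (F y))
      exact mem_subbox.2 ⟨hV x hx y hyE hFxy hagree, fun j hj => (hagree j hj).symm⟩
    calc #{y ∈ E | subbox y (F y) univ = subbox x (F x) univ} * 2 ^ f
        ≤ #(V x) ^ #(F x) * 2 ^ #(F x) := by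
          gcongr
          · exact (card_le_card hclass).trans_eq (card_subbox ..)
          · exact one_le_two
          · exact hf x hx
      _ = (2 * #(V x)) ^ #(F x) := by rw [mul_comm, mul_pow]
      _ ≤ Fintype.card α ^ #(F x) := by gcongr; exact hVcard x hx
      _ = #(subbox x (F x) univ) := by rw [card_subbox, card_univ]

/-- The values taken on the foot `F x` by the points of `E` in the embedded rectangle of `x`,
that is, by those with the same feet `F`, `G` as `x` that agree with `x` off these feet. -/
def footValues [DecidableEq α] (E : Finset (ι → α)) (F G : (ι → α) → Finset ι) (x : ι → α) :
    Finset α :=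
  {y ∈ E | F x = F y ∧ G x = G y ∧ ∀ j, j ∉ F x → j ∉ G x → x j = y j}.biUnion
    fun y => (F x).image y

theorem mem_footValues [DecidableEq α] {E : Finset (ι → α)} {F G : (ι → α) → Finset ι}
    {x : ι → α} {v : α} :
    v ∈ footValues E F G x ↔ ∃ y ∈ E, F x = F y ∧ G x = G y ∧
      (∀ j, j ∉ F x → j ∉ G x → x j = y j) ∧ ∃ i ∈ F x, y i = v := by
  simp only [footValues, mem_biUnion, mem_filter, mem_image, and_assoc]

theorem disjoint_footValues [DecidableEq α] {E : Finset (ι → α)} {F G : (ι → α) → Finset ι}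
    (hne : ∀ x ∈ E, ∀ y ∈ E, F x = F y → G x = G y →
      (∀ j, j ∉ F x → j ∉ G x → x j = y j) → ∀ i ∈ F x, ∀ j ∈ G x, x i ≠ y j) (x : ι → α) :
    Disjoint (footValues E F G x) (footValues E G F x) := by
  rw [disjoint_left]
  intro v hv hv'
  obtain ⟨y, hyE, hFy, hGy, hy, i, hi, rfl⟩ := mem_footValues.1 hv
  obtain ⟨z, hzE, hGz, hFz, hz, j, hj, hji⟩ := mem_footValues.1 hv'
  refine hne y hyE z hzE (hFy.symm.trans hFz) (hGy.symm.trans hGz) ?_ i (hFy ▸ hi) j (hGy ▸ hj)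
    hji.symm
  intro l hlF hlG
  rw [← hFy] at hlF
  rw [← hGy] at hlG
  exact (hy l hlF hlG).symm.trans (hz l hlG hlF)

theorem card_filter_footValues_mul_two_pow_le [Fintype α] [DecidableEq α]
    {E : Finset (ι → α)} {F G : (ι → α) → Finset ι} {f : ℕ}
    (hFG : ∀ x ∈ E, ∀ y ∈ E, (∀ j, j ∉ F x → j ∉ F y → x j = y j) →
      F x = F y ∧ G x = G y) (hf : ∀ x ∈ E, f ≤ #(F x)) :
    #{x ∈ E | 2 * #(footValues E F G x) ≤ Fintype.card α} * 2 ^ f ≤ Fintype.card (ι → α) := by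
  refine card_mul_two_pow_le_of_forall_mem (F := F) (V := footValues E F G) ?_ ?_
    (fun x hx => (mem_filter.1 hx).2) (fun x hx => hf x (mem_filter.1 hx).1)
  · exact fun x hx y hy h => (hFG x (mem_filter.1 hx).1 y (mem_filter.1 hy).1 h).1
  · intro x hx y hy hFxy hagree j hj
    have hyE := (mem_filter.1 hy).1
    exact mem_footValues.2 ⟨y, hyE, hFxy,
      (hFG x (mem_filter.1 hx).1 y hyE fun j hj _ => hagree j hj).2,
      fun j hj _ => hagree j hj, j, hj, rfl⟩

/-- By `hne`, the points of an embedded rectangle take disjoint sets of values on its two feet, so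
one of these sets contains at most half of the alphabet. -/
theorem card_mul_two_pow_le_of_rectangles [Fintype α] {E : Finset (ι → α)}
    {F G : (ι → α) → Finset ι} {f : ℕ}
    (hne : ∀ x ∈ E, ∀ y ∈ E, F x = F y → G x = G y →
      (∀ j, j ∉ F x → j ∉ G x → x j = y j) → ∀ i ∈ F x, ∀ j ∈ G x, x i ≠ y j)
    (hF : ∀ x ∈ E, ∀ y ∈ E, (∀ j, j ∉ F x → j ∉ F y → x j = y j) → F x = F y ∧ G x = G y)
    (hG : ∀ x ∈ E, ∀ y ∈ E, (∀ j, j ∉ G x → j ∉ G y → x j = y j) → F x = F y ∧ G x = G y)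
    (hfF : ∀ x ∈ E, f ≤ #(F x)) (hfG : ∀ x ∈ E, f ≤ #(G x)) :
    #E * 2 ^ f ≤ 2 * Fintype.card (ι → α) := by
  classical
  have hcover : #E ≤ #{x ∈ E | 2 * #(footValues E F G x) ≤ Fintype.card α} +
      #{x ∈ E | 2 * #(footValues E G F x) ≤ Fintype.card α} := by
    refine (card_le_card fun x hx => ?_).trans (card_union_le _ _)
    have hle := card_le_univ (footValues E F G x ∪ footValues E G F x)
    rw [card_union_of_disjoint (disjoint_footValues hne x)] at hle
    simp only [mem_union, mem_filter, hx, true_and]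
    omega
  calc #E * 2 ^ f ≤ _ := Nat.mul_le_mul_right _ hcover
    _ ≤ Fintype.card (ι → α) + Fintype.card (ι → α) := by
        rw [add_mul]
        exact add_le_add (card_filter_footValues_mul_two_pow_le hF hfF)
          (card_filter_footValues_mul_two_pow_le (fun x hx y hy h => (hG x hx y hy h).symm) hfG)
    _ = 2 * Fintype.card (ι → α) := (two_mul _).symm

end Rectangles

section Colourings

open Finset

/-- Chebyshev's inequality for the uniform distribution on `β`. -/
theorem card_filter_lt_half_mul_sq_le {β : Type*} [Fintype β] {f : β → ℝ} {m v : ℝ} (hm : 0 ≤ m)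
    (hmean : ∑ x, f x = Fintype.card β * m) (hsq : ∑ x, f x ^ 2 ≤ Fintype.card β * (m ^ 2 + v)) :
    (#{x | f x < m / 2} : ℝ) * m ^ 2 ≤ 4 * (Fintype.card β * v) := by
  have hvar : ∑ x, (f x - m) ^ 2 ≤ Fintype.card β * v := by
    simp only [sub_sq, sum_add_distrib, sum_sub_distrib, ← sum_mul, ← mul_sum, hmean, sum_const,
      card_univ, nsmul_eq_mul]
    linarith
  have hlow : (#{x | f x < m / 2} : ℝ) * (m ^ 2 / 4) ≤ ∑ x, (f x - m) ^ 2 := by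
    calc (#{x | f x < m / 2} : ℝ) * (m ^ 2 / 4) = ∑ x with f x < m / 2, m ^ 2 / 4 := by
          rw [sum_const, nsmul_eq_mul]
      _ ≤ ∑ x with f x < m / 2, (f x - m) ^ 2 := by
          refine sum_le_sum fun x hx => ?_
          have := (mem_filter.1 hx).2
          nlinarith
      _ ≤ ∑ x, (f x - m) ^ 2 :=
          sum_le_sum_of_subset_of_nonneg (subset_univ _) fun _ _ _ => sq_nonneg _
  linarith

theorem card_filter_not_disjoint_le {J R : Type*} [DecidableEq R] {s : J → Finset R}
    {A : Finset J} {H : ℕ} (hH : ∀ t, #{j ∈ A | t ∈ s j} ≤ H) (S : Finset R) :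
    #{j ∈ A | ¬ Disjoint S (s j)} ≤ #S * H := by
  classical
  have hsub : {j ∈ A | ¬ Disjoint S (s j)} ⊆ S.biUnion fun t => {j ∈ A | t ∈ s j} := by
    intro j hj
    obtain ⟨hjA, hjS⟩ := mem_filter.1 hj
    obtain ⟨t, htS, htj⟩ := not_disjoint_iff.1 hjS
    exact mem_biUnion.2 ⟨t, htS, mem_filter.2 ⟨hjA, htj⟩⟩
  exact (card_le_card hsub).trans (card_biUnion_le_card_mul _ _ H fun t _ => hH t)

variable {J R C : Type*} [DecidableEq C]

/-- The number of indices `j` whose set `s j` has `l` elements. -/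
def levelCount [Fintype J] (s : J → Finset R) (l : ℕ) : ℕ := #{j | #(s j) = l}

/-- The indices `j` such that the colouring `g` has colour `a` on all of `s j`. -/
def monoSet [Fintype J] (s : J → Finset R) (g : R → C) (a : C) : Finset J :=
  {j | ∀ t ∈ s j, g t = a}

/-- The indices `j` such that `g` has colour `a` on exactly `l` elements of `s j` and colour `b` on
the others. -/
def levelSet [Fintype J] (s : J → Finset R) (g : R → C) (a b : C) (l : ℕ) : Finset J :=
  {j | #{t ∈ s j | g t = a} = l ∧ ∀ t ∈ s j, g t = a ∨ g t = b}

theorem monoSet_congr [Fintype J] {s s' : J → Finset R} {g : R → C} {b : C}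
    (h : ∀ r, g r ≠ b → ∀ j, r ∈ s j ↔ r ∈ s' j) : monoSet s g b = monoSet s' g b := by
  ext j
  simp only [monoSet, mem_filter, mem_univ, true_and]
  refine forall_congr' fun r => ?_
  by_cases hr : g r = b
  · simp only [hr, implies_true]
  · rw [h r hr j]

theorem levelSet_congr [Fintype J] {s s' : J → Finset R} {g : R → C} {a b : C} {l : ℕ}
    (hab : a ≠ b) (h : ∀ r, g r ≠ b → ∀ j, r ∈ s j ↔ r ∈ s' j) :
    levelSet s g a b l = levelSet s' g a b l := by
  ext j
  have hfilter : {r ∈ s j | g r = a} = {r ∈ s' j | g r = a} := by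
    ext r
    simp only [mem_filter]
    exact and_congr_left fun hr => h r (hr ▸ hab) j
  simp only [levelSet, mem_filter, mem_univ, true_and, hfilter]
  refine and_congr_right fun _ => forall_congr' fun r => ?_
  by_cases hr : g r = b
  · simp only [hr, or_true, implies_true]
  · rw [h r hr j]

/-- The indices at which `levelSet s g a b l` fails to approximate `monoSet s g a`. -/
def deviation [Fintype J] [DecidableEq J] (s : J → Finset R) (g : R → C) (a b : C) (l : ℕ) :
    Finset J :=
  symmDiff (monoSet s g a) (levelSet s g a b l)

theorem notMem_deviation_of_card_eq [Fintype J] [DecidableEq J] {s : J → Finset R} {j : J} {l : ℕ}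
    (hj : #(s j) = l) (g : R → C) (a b : C) : j ∉ deviation s g a b l := by
  simp only [deviation, mem_symmDiff, monoSet, levelSet, mem_filter, mem_univ, true_and]
  rintro (⟨hmono, hlevel⟩ | ⟨⟨hcard, -⟩, hmono⟩)
  · exact hlevel ⟨by rw [filter_true_of_mem hmono, hj], fun t ht => Or.inl (hmono t ht)⟩
  · exact hmono (filter_eq_self.1 (eq_of_subset_of_card_le (filter_subset _ _) (by omega)))

variable [DecidableEq R] [Fintype R] [Fintype C]

theorem card_filter_forall_mem_eq (S : Finset R) (c : R → C) :
    (#{g : R → C | ∀ t ∈ S, g t = c t} : ℝ) = Fintype.card (R → C) / (Fintype.card C : ℝ) ^ #S := by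
  have hbox : ({g : R → C | ∀ t ∈ S, g t = c t} : Finset (R → C)) = subbox c Sᶜ univ := by
    ext g
    simp [mem_subbox_univ]
  have hne : (Fintype.card C : ℝ) ^ #S ≠ 0 := by
    rcases S.eq_empty_or_nonempty with rfl | ⟨t, -⟩
    · simp
    · have : Nonempty C := ⟨c t⟩
      positivity
  rw [hbox, card_subbox, eq_div_iff hne, Fintype.card_fun, ← card_compl_add_card S,
    pow_add, card_univ]
  push_cast
  rfl

theorem sum_card_filter_mono {s : J → Finset R} {A : Finset J} {l : ℕ}
    (hA : ∀ j ∈ A, #(s j) = l) (a : C) :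
    ∑ g : R → C, (#{j ∈ A | ∀ t ∈ s j, g t = a} : ℝ) =
      Fintype.card (R → C) * (#A / (Fintype.card C : ℝ) ^ l) := by
  calc ∑ g : R → C, (#{j ∈ A | ∀ t ∈ s j, g t = a} : ℝ)
      = ∑ j ∈ A, (#{g : R → C | ∀ t ∈ s j, g t = a} : ℝ) := by
        simp only [← sum_boole]
        exact sum_comm
    _ = ∑ _j ∈ A, (Fintype.card (R → C) / (Fintype.card C : ℝ) ^ l) :=
        sum_congr rfl fun j hj => by rw [card_filter_forall_mem_eq _ fun _ => a, hA j hj]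
    _ = Fintype.card (R → C) * (#A / (Fintype.card C : ℝ) ^ l) := by
        rw [sum_const, nsmul_eq_mul]
        ring

theorem sum_sq_card_filter_mono (s : J → Finset R) (A : Finset J) (a : C) :
    ∑ g : R → C, (#{j ∈ A | ∀ t ∈ s j, g t = a} : ℝ) ^ 2 =
      ∑ i ∈ A, ∑ j ∈ A, (#{g : R → C | ∀ t ∈ s i ∪ s j, g t = a} : ℝ) := by
  have hmul (g : R → C) (i j : J) : (if ∀ t ∈ s i ∪ s j, g t = a then (1 : ℝ) else 0) =
      (if ∀ t ∈ s i, g t = a then 1 else 0) * (if ∀ t ∈ s j, g t = a then 1 else 0) := by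
    rw [if_congr forall_mem_union rfl rfl, ite_zero_mul_ite_zero, one_mul]
  simp only [← sum_boole, hmul, sq, sum_mul_sum]
  rw [sum_comm]
  exact sum_congr rfl fun i _ => sum_comm

/-- The two events are independent when the two sets are disjoint, and otherwise the second one is
dropped. -/
theorem card_filter_mono_union_le {S S' : Finset R} (hcard : #S' = #S) (a : C) :
    (#{g : R → C | ∀ t ∈ S ∪ S', g t = a} : ℝ) ≤ Fintype.card (R → C) / (Fintype.card C : ℝ) ^ #S *
      (1 / (Fintype.card C : ℝ) ^ #S + if Disjoint S S' then 0 else 1) := by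
  by_cases hdisj : Disjoint S S'
  · rw [card_filter_forall_mem_eq _ fun _ => a, card_union_of_disjoint hdisj, hcard, if_pos hdisj,
      pow_add, add_zero, div_mul_div_comm, mul_one]
  · have hmono : (#{g : R → C | ∀ t ∈ S ∪ S', g t = a} : ℝ) ≤
        #{g : R → C | ∀ t ∈ S, g t = a} := by
      gcongr
      exact subset_union_left
    rw [card_filter_forall_mem_eq S fun _ => a] at hmono
    rw [if_neg hdisj]
    refine hmono.trans (le_mul_of_one_le_right (by positivity) ?_)
    exact le_add_of_nonneg_left (by positivity)

theorem sum_sq_card_filter_mono_le {s : J → Finset R} {A : Finset J} {l H : ℕ}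
    (hA : ∀ j ∈ A, #(s j) = l) (hH : ∀ t, #{j ∈ A | t ∈ s j} ≤ H) (a : C) :
    ∑ g : R → C, (#{j ∈ A | ∀ t ∈ s j, g t = a} : ℝ) ^ 2 ≤ Fintype.card (R → C) *
      ((#A / (Fintype.card C : ℝ) ^ l) ^ 2 + #A / (Fintype.card C : ℝ) ^ l * (l * H)) := by
  have hrow : ∀ i ∈ A, ∑ j ∈ A, (#{g : R → C | ∀ t ∈ s i ∪ s j, g t = a} : ℝ) ≤
      Fintype.card (R → C) / (Fintype.card C : ℝ) ^ l *
        (#A / (Fintype.card C : ℝ) ^ l + l * H) := by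
    intro i hi
    have hdeg : (#{j ∈ A | ¬ Disjoint (s i) (s j)} : ℝ) ≤ l * H := by
      exact_mod_cast hA i hi ▸ card_filter_not_disjoint_le hH (s i)
    calc ∑ j ∈ A, (#{g : R → C | ∀ t ∈ s i ∪ s j, g t = a} : ℝ)
        ≤ ∑ j ∈ A, Fintype.card (R → C) / (Fintype.card C : ℝ) ^ l *
            (1 / (Fintype.card C : ℝ) ^ l + if ¬ Disjoint (s i) (s j) then 1 else 0) := by
          refine sum_le_sum fun j hj => ?_
          rw [ite_not, ← hA i hi]
          exact card_filter_mono_union_le ((hA j hj).trans (hA i hi).symm) a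
      _ = Fintype.card (R → C) / (Fintype.card C : ℝ) ^ l *
            (#A / (Fintype.card C : ℝ) ^ l + #{j ∈ A | ¬ Disjoint (s i) (s j)}) := by
          rw [← mul_sum, sum_add_distrib, sum_boole, sum_const, nsmul_eq_mul, mul_one_div]
      _ ≤ _ := by gcongr
  calc _ = _ := sum_sq_card_filter_mono s A a
    _ ≤ _ := sum_le_sum hrow
    _ = _ := by rw [sum_const, nsmul_eq_mul]; ring

theorem card_filter_card_monoSet_lt_mul_le [Fintype J] {s : J → Finset R} {l H : ℕ}
    (hH : ∀ t, #{j | t ∈ s j} ≤ H) (a : C) {m : ℝ}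
    (hm : m = levelCount s l / (Fintype.card C : ℝ) ^ l) (hmpos : 0 < m) :
    (#{g : R → C | (#(monoSet s g a) : ℝ) < m / 2} : ℝ) * m ≤
      4 * (l * H) * Fintype.card (R → C) := by
  let A : Finset J := {j | #(s j) = l}
  have hA : ∀ j ∈ A, #(s j) = l := fun j hj => (mem_filter.1 hj).2
  have hHA : ∀ t, #{j ∈ A | t ∈ s j} ≤ H := fun t =>
    (card_le_card (filter_subset_filter _ (subset_univ A))).trans (hH t)
  have hcheb := card_filter_lt_half_mul_sq_le hmpos.le
    ((sum_card_filter_mono hA a).trans (by rw [hm]; rfl))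
    ((sum_sq_card_filter_mono_le hA hHA a).trans_eq (by rw [hm]; rfl))
  have hle : (#{g : R → C | (#(monoSet s g a) : ℝ) < m / 2} : ℝ) ≤
      #{g : R → C | (#{j ∈ A | ∀ t ∈ s j, g t = a} : ℝ) < m / 2} := by
    refine Nat.cast_le.2 (card_le_card (monotone_filter_right _ fun g _ hg => lt_of_le_of_lt ?_ hg))
    refine Nat.cast_le.2 (card_le_card fun j hj => ?_)
    simp only [monoSet, mem_filter, mem_univ, true_and] at hj ⊢
    exact hj.2
  refine le_of_mul_le_mul_right ?_ hmpos
  calc _ = (#{g : R → C | (#(monoSet s g a) : ℝ) < m / 2} : ℝ) * m ^ 2 := by ring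
    _ ≤ _ := mul_le_mul_of_nonneg_right hle (sq_nonneg m)
    _ ≤ _ := hcheb
    _ = 4 * (Fintype.card (R → C) * (m * (l * H))) := by rw [hm]; rfl
    _ = _ := by ring

theorem card_filter_mem_deviation_le [Fintype J] [DecidableEq J] (s : J → Finset R) (a b : C)
    (l : ℕ) (j : J) :
    (#{g : R → C | j ∈ deviation s g a b l} : ℝ) ≤
      (1 + (#(s j)).choose l) * (Fintype.card (R → C) / (Fintype.card C : ℝ) ^ #(s j)) := by
  have hsub : ({g : R → C | j ∈ deviation s g a b l} : Finset (R → C)) ⊆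
      ({g : R → C | ∀ t ∈ s j, g t = a} : Finset (R → C)) ∪
        ((s j).powersetCard l).biUnion fun S => {g | ∀ t ∈ s j, g t = if t ∈ S then a else b} := by
    intro g hg
    simp only [deviation, mem_symmDiff, monoSet, levelSet, mem_filter, mem_univ, true_and] at hg
    simp only [mem_union, mem_filter, mem_univ, true_and, mem_biUnion, mem_powersetCard]
    refine hg.imp And.left fun ⟨⟨hcard, hab⟩, _⟩ => ?_
    refine ⟨_, ⟨filter_subset (fun t => g t = a) _, hcard⟩, fun t ht => ?_⟩
    by_cases hta : g t = a
    · simp [ht, hta]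
    · simp [(hab t ht).resolve_left hta]
  calc (#{g : R → C | j ∈ deviation s g a b l} : ℝ)
      ≤ #{g : R → C | ∀ t ∈ s j, g t = a} + ∑ S ∈ (s j).powersetCard l,
          (#{g : R → C | ∀ t ∈ s j, g t = if t ∈ S then a else b} : ℝ) := by
        exact_mod_cast (card_le_card hsub).trans ((card_union_le _ _).trans
          (Nat.add_le_add_left card_biUnion_le _))
    _ = _ := by
        rw [card_filter_forall_mem_eq _ fun _ => a, sum_congr rfl fun S _ =>
          card_filter_forall_mem_eq (s j) fun t => if t ∈ S then a else b, sum_const,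
          card_powersetCard, nsmul_eq_mul]
        ring

theorem sum_card_deviation_le [Fintype J] [DecidableEq J] (s : J → Finset R) (a b : C) (l : ℕ) :
    ∑ g : R → C, (#(deviation s g a b l) : ℝ) ≤ Fintype.card (R → C) *
      ∑ k ∈ (range (Fintype.card R + 1)).erase l,
        levelCount s k * (1 + k.choose l : ℝ) / (Fintype.card C : ℝ) ^ k := by
  let p : J → ℝ := fun j =>
    (1 + (#(s j)).choose l) * (Fintype.card (R → C) / (Fintype.card C : ℝ) ^ #(s j))
  calc ∑ g : R → C, (#(deviation s g a b l) : ℝ)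
      = ∑ j, (#{g : R → C | j ∈ deviation s g a b l} : ℝ) := by
        simp only [← sum_boole]
        rw [sum_comm]
        simp
    _ = ∑ j with #(s j) ≠ l, (#{g : R → C | j ∈ deviation s g a b l} : ℝ) := by
        refine (sum_filter_of_ne (p := fun j => #(s j) ≠ l) fun j _ hne hj => hne ?_).symm
        simp [notMem_deviation_of_card_eq hj]
    _ ≤ ∑ j with #(s j) ≠ l, p j :=
        sum_le_sum fun j _ => card_filter_mem_deviation_le s a b l j
    _ = ∑ k ∈ (range (Fintype.card R + 1)).erase l, ∑ j with #(s j) ≠ l ∧ #(s j) = k, p j := by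
        simp only [← filter_filter]
        refine (sum_fiberwise_of_maps_to (fun j hj => ?_) p).symm
        exact mem_erase.2 ⟨(mem_filter.1 hj).2, mem_range_succ_iff.2 (card_le_univ _)⟩
    _ = _ := by
        rw [mul_sum]
        refine sum_congr rfl fun k hk => ?_
        rw [filter_congr (q := fun j => #(s j) = k)
          fun j _ => and_iff_right_of_imp fun h => h ▸ ne_of_mem_erase hk,
          sum_congr rfl (g := fun _ =>
            (1 + k.choose l) * (Fintype.card (R → C) / (Fintype.card C : ℝ) ^ k))
          fun j hj => by simp only [p, (mem_filter.1 hj).2],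
          sum_const, nsmul_eq_mul, levelCount]
        ring

end Colourings

section DominantLevels

open Finset

theorem exists_popular_level {J : Type*} [Fintype J] [Nonempty J] {d : J → ℕ} {k : ℕ}
    (hd : ∀ j, 1 ≤ d j) (hsum : ∑ j, d j ≤ k * Fintype.card J) :
    ∃ l ∈ Icc 1 (2 * k), (Fintype.card J : ℝ) ≤ 4 * k * #{j | d j = l} := by
  have hk : 1 ≤ k := by
    have hcard : Fintype.card J ≤ ∑ j, d j := by
      simpa using sum_le_sum (s := univ) fun j _ => hd j
    exact Nat.pos_of_mul_pos_right (Fintype.card_pos.trans_le (hcard.trans hsum))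
  have hmarkov : 2 * #{j | ¬ d j ≤ 2 * k} ≤ Fintype.card J := by
    have h : #{j | ¬ d j ≤ 2 * k} * (2 * k) ≤ k * Fintype.card J :=
      calc #{j | ¬ d j ≤ 2 * k} * (2 * k) ≤ ∑ j with ¬ d j ≤ 2 * k, d j :=
            card_nsmul_le_sum _ _ _ fun j hj => (not_le.1 (mem_filter.1 hj).2).le
        _ ≤ ∑ j, d j := sum_le_sum_of_subset (subset_univ _)
        _ ≤ k * Fintype.card J := hsum
    exact Nat.le_of_mul_le_mul_left (by linarith) hk
  have hhalf : (Fintype.card J : ℝ) ≤ 2 * #{j | d j ≤ 2 * k} := by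
    have h := card_filter_add_card_filter_not (s := (univ : Finset J)) fun j => d j ≤ 2 * k
    rw [card_univ] at h
    exact_mod_cast (by omega : Fintype.card J ≤ 2 * #{j | d j ≤ 2 * k})
  have : (0 : ℝ) < k := by exact_mod_cast hk
  obtain ⟨l, hl, hcard⟩ := exists_le_card_fiber_of_nsmul_le_card_of_maps_to
    (s := {j | d j ≤ 2 * k}) (t := Icc 1 (2 * k)) (f := d) (b := (Fintype.card J / (4 * k) : ℝ))
    (fun j hj => mem_Icc.2 ⟨hd j, (mem_filter.1 hj).2⟩) ⟨1, mem_Icc.2 ⟨le_rfl, by omega⟩⟩ (by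
      rw [Nat.card_Icc, Nat.add_sub_cancel, nsmul_eq_mul]
      push_cast
      field_simp
      linarith)
  refine ⟨l, hl, ?_⟩
  rw [div_le_iff₀ (by positivity)] at hcard
  calc (Fintype.card J : ℝ) ≤ #{j ∈ {j | d j ≤ 2 * k} | d j = l} * (4 * k) := hcard
    _ ≤ #{j | d j = l} * (4 * k) := by gcongr; exact subset_univ _
    _ = 4 * k * #{j | d j = l} := mul_comm _ _

/-- The level `l` maximises the weights `c a / q ^ a`. -/
def IsScaledMax (c : ℕ → ℝ) (q : ℝ) (l : ℕ) : Prop := ∀ a, c a / q ^ a ≤ c l / q ^ l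

/-- With the weights `c a / K ^ a`, the level `l` outweighs the levels at distance `d` from it by
the factor `Q ^ d`. -/
def DominantLevel (c : ℕ → ℝ) (K Q : ℝ) (l : ℕ) : Prop :=
  ∀ a, c a / K ^ a ≤ c l / K ^ l / Q ^ Nat.dist a l

variable {c : ℕ → ℝ} {q q' K Q : ℝ} {l l' l₀ L : ℕ}

theorem exists_isScaledMax (hq : 1 ≤ q) (hl₀ : l₀ ∈ Icc 1 L) (hc₀ : c 0 = 0) (hpos : 0 < c l₀)
    (hc : ∀ a, c a ≤ q * c l₀) : ∃ l ∈ Icc 1 L, IsScaledMax c q l := by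
  obtain ⟨l, hl, hmax⟩ := exists_max_image (Icc 1 L) (fun a => c a / q ^ a) ⟨l₀, hl₀⟩
  refine ⟨l, hl, fun a => ?_⟩
  by_cases ha : a ∈ Icc 1 L
  · exact hmax a ha
  refine le_trans ?_ (hmax l₀ hl₀)
  rw [mem_Icc] at ha hl₀
  rcases Nat.eq_zero_or_pos a with rfl | ha₀
  · rw [hc₀, zero_div]
    positivity
  · calc c a / q ^ a ≤ q * c l₀ / q ^ (l₀ + 1) := by
          gcongr
          · exact hc a
          · omega
      _ = c l₀ / q ^ l₀ := by rw [pow_succ', mul_div_mul_left _ _ (by positivity)]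

theorem IsScaledMax.pos (h : IsScaledMax c q l) (hq : 0 < q) (hpos : 0 < c l₀) : 0 < c l :=
  (div_pos_iff_of_pos_right (pow_pos hq l)).1 ((div_pos hpos (pow_pos hq l₀)).trans_le (h l₀))

theorem IsScaledMax.le_of_lt (h : IsScaledMax c q l) (h' : IsScaledMax c q' l') (hq : 0 < q)
    (hqq' : q < q') (hpos : 0 < c l) : l' ≤ l := by
  by_contra! hlt
  obtain ⟨d, hd, rfl⟩ := exists_pos_add_of_lt' hlt
  have hq' : 0 < q' := hq.trans hqq'
  have hle : c (l + d) ≤ c l * q ^ d := by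
    have := h (l + d)
    rwa [pow_add, ← div_div, div_right_comm, div_le_div_iff_of_pos_right (by positivity),
      div_le_iff₀ (by positivity)] at this
  have hge : c l * q' ^ d ≤ c (l + d) := by
    have := h' l
    rwa [pow_add, ← div_div, div_right_comm, div_le_div_iff_of_pos_right (by positivity),
      le_div_iff₀ (by positivity)] at this
  exact (pow_lt_pow_left₀ hqq' hq.le hd.ne').not_ge (le_of_mul_le_mul_left (hge.trans hle) hpos)

theorem IsScaledMax.dominantLevel (hlow : IsScaledMax c (K / Q) l) (hhigh : IsScaledMax c (K * Q) l)
    (hK : 0 < K) (hQ : 0 < Q) : DominantLevel c K Q l := by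
  intro a
  rcases le_total a l with hal | hla
  · obtain ⟨d, rfl⟩ := Nat.exists_eq_add_of_le hal
    have h := hhigh a
    rw [Nat.dist_eq_sub_of_le hal, Nat.add_sub_cancel_left]
    rw [mul_pow, mul_pow, ← div_div, ← div_div, div_le_iff₀ (by positivity)] at h
    refine h.trans_eq ?_
    field_simp
    ring
  · obtain ⟨d, rfl⟩ := Nat.exists_eq_add_of_le hla
    have h := hlow (l + d)
    rw [Nat.dist_eq_sub_of_le_right hla, Nat.add_sub_cancel_left]
    rw [div_pow, div_pow, div_div_eq_mul_div, div_div_eq_mul_div, mul_div_right_comm,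
      mul_div_right_comm, ← le_div_iff₀ (by positivity)] at h
    refine h.trans_eq ?_
    field_simp
    ring

theorem exists_lt_eq_succ_of_antitone {v : ℕ → ℕ} (hv : Antitone v) (hmem : ∀ j, v j ∈ Icc 1 L) :
    ∃ j < L, v j = v (j + 1) := by
  by_contra! hne
  have hdrop : ∀ j ≤ L, v j + j ≤ L := by
    intro j
    induction j with
    | zero => exact fun _ => (mem_Icc.1 (hmem 0)).2
    | succ j ih =>
      intro hj
      have : v (j + 1) < v j := lt_of_le_of_ne (hv j.le_succ) (hne j hj).symm
      have := ih (by omega)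
      omega
  have := hdrop L le_rfl
  have := (mem_Icc.1 (hmem L)).1
  omega

/-- The maximisers at the scales `Q ^ 1, Q ^ 3, …, Q ^ (2 L + 1)` decrease within `[1, L]`, so two
consecutive ones coincide. -/
theorem exists_dominantLevel (hQ : 1 < Q) (hl₀ : l₀ ∈ Icc 1 L) (hc₀ : c 0 = 0) (hpos : 0 < c l₀)
    (hc : ∀ a, c a ≤ Q * c l₀) :
    ∃ i ∈ Icc 1 (2 * L), ∃ l ∈ Icc 1 L, DominantLevel c (Q ^ i) Q l ∧
      c l₀ / Q ^ ((2 * L + 1) * L) ≤ c l / (Q ^ i) ^ l := by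
  have hQ₀ : 0 < Q := one_pos.trans hQ
  have hmax : ∀ j : ℕ, ∃ l ∈ Icc 1 L, IsScaledMax c (Q ^ (2 * j + 1)) l := fun j =>
    exists_isScaledMax (one_le_pow₀ hQ.le) hl₀ hc₀ hpos fun a =>
      (hc a).trans (mul_le_mul_of_nonneg_right (le_self_pow₀ hQ.le (by omega)) hpos.le)
  choose v hv hvmax using hmax
  have hanti : Antitone v := antitone_nat_of_succ_le fun j =>
    (hvmax j).le_of_lt (hvmax (j + 1)) (by positivity) (pow_lt_pow_right₀ hQ (by omega))
      ((hvmax j).pos (by positivity) hpos)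
  obtain ⟨j, hjL, hj⟩ := exists_lt_eq_succ_of_antitone hanti hv
  have hhigh : IsScaledMax c (Q ^ (2 * j + 3)) (v j) := hj ▸ hvmax (j + 1)
  have hvpos : 0 < c (v j) := hhigh.pos (by positivity) hpos
  refine ⟨2 * j + 2, mem_Icc.2 ⟨by omega, by omega⟩, v j, hv j, ?_, ?_⟩
  · refine IsScaledMax.dominantLevel ?_ ?_ (by positivity) hQ₀
    · rw [pow_succ Q (2 * j + 1), mul_div_cancel_right₀ _ hQ₀.ne']
      exact hvmax j
    · exact pow_succ Q (2 * j + 2) ▸ hhigh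
  · calc c l₀ / Q ^ ((2 * L + 1) * L) ≤ c l₀ / (Q ^ (2 * j + 3)) ^ l₀ := by
          rw [← pow_mul]
          have hexp : (2 * j + 3) * l₀ ≤ (2 * L + 1) * L :=
            Nat.mul_le_mul (by omega) (mem_Icc.1 hl₀).2
          exact div_le_div_of_nonneg_left hpos.le (by positivity) (pow_le_pow_right₀ hQ.le hexp)
      _ ≤ c (v j) / (Q ^ (2 * j + 3)) ^ v j := hhigh l₀
      _ ≤ c (v j) / (Q ^ (2 * j + 2)) ^ v j := by
          gcongr
          exacts [hQ.le, by omega]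

theorem choose_add_le_pow (l d : ℕ) : (l + d).choose l ≤ (l + 1) ^ d := by
  induction d with
  | zero => simp
  | succ d ih =>
    have hrec : (l + d + 1).choose l * (d + 1) = (l + d).choose l * (l + d + 1) := by
      have := Nat.choose_mul_succ_eq (l + d) l
      rw [add_assoc l d 1, Nat.add_sub_cancel_left, ← add_assoc] at this
      exact this.symm
    refine Nat.le_of_mul_le_mul_right ?_ d.succ_pos
    calc (l + d + 1).choose l * (d + 1) = (l + d).choose l * (l + d + 1) := hrec
      _ ≤ (l + 1) ^ d * ((l + 1) * (d + 1)) := Nat.mul_le_mul ih (by nlinarith)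
      _ = (l + 1) ^ (d + 1) * (d + 1) := by ring

theorem choose_le_pow_dist (a l : ℕ) : a.choose l ≤ (l + 1) ^ Nat.dist a l := by
  rcases lt_or_ge a l with hal | hla
  · rw [Nat.choose_eq_zero_of_lt hal]
    exact Nat.zero_le _
  · obtain ⟨d, rfl⟩ := Nat.exists_eq_add_of_le hla
    rw [Nat.dist_eq_sub_of_le_right hla, Nat.add_sub_cancel_left]
    exact choose_add_le_pow l d

theorem sum_pow_le_two_mul {ρ : ℝ} (hρ₀ : 0 ≤ ρ) (hρ : ρ ≤ 1 / 2) {t : Finset ℕ} {e : ℕ → ℕ}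
    (hinj : Set.InjOn e t) (he : ∀ a ∈ t, 1 ≤ e a) : ∑ a ∈ t, ρ ^ e a ≤ 2 * ρ := by
  have hinj' : Set.InjOn (fun a => e a - 1) t := fun a ha b hb hab => hinj ha hb (by
    have := he a ha
    have := he b hb
    simp only at hab
    omega)
  calc ∑ a ∈ t, ρ ^ e a = ρ * ∑ a ∈ t, ρ ^ (e a - 1) := by
        rw [mul_sum]
        exact sum_congr rfl fun a ha => by rw [← pow_succ', Nat.sub_add_cancel (he a ha)]
    _ = ρ * ∑ d ∈ t.image fun a => e a - 1, ρ ^ d := by rw [sum_image hinj']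
    _ ≤ ρ * 2 := by
        gcongr
        calc ∑ d ∈ t.image fun a => e a - 1, ρ ^ d ≤ ∑' d : ℕ, ρ ^ d :=
              (summable_geometric_of_lt_one hρ₀ (by linarith)).sum_le_tsum _
                fun _ _ => by positivity
          _ = (1 - ρ)⁻¹ := tsum_geometric_of_lt_one hρ₀ (by linarith)
          _ ≤ 2 := by
              rw [inv_le_comm₀ (by linarith) two_pos]
              linarith
    _ = 2 * ρ := mul_comm _ _

theorem sum_pow_dist_le_four_mul {ρ : ℝ} (hρ₀ : 0 ≤ ρ) (hρ : ρ ≤ 1 / 2) {t : Finset ℕ}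
    (hl : l ∉ t) : ∑ a ∈ t, ρ ^ Nat.dist a l ≤ 4 * ρ := by
  have hne : ∀ a ∈ t, a ≠ l := fun a ha h => hl (h ▸ ha)
  have hbelow : ∑ a ∈ t with a < l, ρ ^ Nat.dist a l ≤ 2 * ρ := by
    refine sum_pow_le_two_mul hρ₀ hρ (fun a ha b hb hab => ?_) fun a ha => ?_
    all_goals simp only [Nat.dist, coe_filter, mem_filter, Set.mem_ofPred_eq] at *; omega
  have habove : ∑ a ∈ t with ¬ a < l, ρ ^ Nat.dist a l ≤ 2 * ρ := by
    refine sum_pow_le_two_mul hρ₀ hρ (fun a ha b hb hab => ?_) fun a ha => ?_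
    · simp only [Nat.dist, coe_filter, Set.mem_ofPred_eq] at *
      omega
    · obtain ⟨hat, hal⟩ := mem_filter.1 ha
      have := hne a hat
      simp only [Nat.dist]
      omega
  rw [← sum_filter_add_sum_filter_not t (· < l)]
  linarith

theorem DominantLevel.sum_choose_le (h : DominantLevel c K Q l) (hm : 0 ≤ c l / K ^ l)
    (hQ : 2 * (l + 1) ≤ Q) {t : Finset ℕ} (hl : l ∉ t) :
    ∑ a ∈ t, c a * (1 + a.choose l) / K ^ a ≤ 8 * ((l + 1) / Q) * (c l / K ^ l) := by
  have hQ₀ : 0 < Q := lt_of_lt_of_le (by positivity) hQ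
  have hρ : (l + 1) / Q ≤ 1 / 2 := by
    rw [div_le_iff₀ hQ₀]
    linarith
  have hchoose (a : ℕ) : (1 : ℝ) + a.choose l ≤ 2 * (l + 1) ^ Nat.dist a l := by
    have h₁ : (a.choose l : ℝ) ≤ (l + 1) ^ Nat.dist a l := by exact_mod_cast choose_le_pow_dist a l
    have h₂ : (1 : ℝ) ≤ (l + 1) ^ Nat.dist a l := one_le_pow₀ (by simp)
    linarith
  calc ∑ a ∈ t, c a * (1 + a.choose l) / K ^ a
      ≤ ∑ a ∈ t, 2 * (c l / K ^ l) * ((l + 1) / Q) ^ Nat.dist a l := by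
        refine sum_le_sum fun a _ => ?_
        calc c a * (1 + a.choose l) / K ^ a = c a / K ^ a * (1 + a.choose l) := by ring
          _ ≤ c l / K ^ l / Q ^ Nat.dist a l * (1 + a.choose l) :=
              mul_le_mul_of_nonneg_right (h a) (by positivity)
          _ ≤ c l / K ^ l / Q ^ Nat.dist a l * (2 * (l + 1) ^ Nat.dist a l) := by
              gcongr
              exact hchoose a
          _ = 2 * (c l / K ^ l) * ((l + 1) / Q) ^ Nat.dist a l := by rw [div_pow]; ring
    _ = 2 * (c l / K ^ l) * ∑ a ∈ t, ((l + 1) / Q) ^ Nat.dist a l := by rw [mul_sum]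
    _ ≤ 2 * (c l / K ^ l) * (4 * ((l + 1) / Q)) := by
        gcongr
        exact sum_pow_dist_le_four_mul (by positivity) hρ hl
    _ = 8 * ((l + 1) / Q) * (c l / K ^ l) := by ring

theorem exists_dominantLevel_levelCount {J R : Type*} [Fintype J] [Nonempty J]
    {s : J → Finset R} (hs : ∀ j, (s j).Nonempty) {k : ℕ}
    (hsum : ∑ j, #(s j) ≤ k * Fintype.card J) (hk : 4 * k ≤ Q) (hQ : 1 < Q) :
    ∃ i ∈ Icc 1 (4 * k), ∃ l ∈ Icc 1 (2 * k),
      DominantLevel (fun a => levelCount s a) (Q ^ i) Q l ∧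
        Fintype.card J / Q ^ (8 * k ^ 2 + 2 * k + 1) ≤ levelCount s l / (Q ^ i) ^ l := by
  have hQ₀ : 0 < Q := one_pos.trans hQ
  obtain ⟨l₀, hl₀, hpop⟩ := exists_popular_level (fun j => card_pos.2 (hs j)) hsum
  replace hpop : (Fintype.card J : ℝ) ≤ Q * levelCount s l₀ :=
    hpop.trans (mul_le_mul_of_nonneg_right hk (Nat.cast_nonneg _))
  have hcard : (0 : ℝ) < Fintype.card J := Nat.cast_pos.2 Fintype.card_pos
  have hpos : (0 : ℝ) < levelCount s l₀ := pos_of_mul_pos_right (hcard.trans_le hpop) hQ₀.le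
  have hzero : ((levelCount s 0 : ℕ) : ℝ) = 0 := by
    simp [levelCount, (hs _).ne_empty]
  have hle (a : ℕ) : (levelCount s a : ℝ) ≤ Q * levelCount s l₀ :=
    (Nat.cast_le.2 (card_le_univ _)).trans hpop
  obtain ⟨i, hi, l, hl, hdom, hlow⟩ :=
    exists_dominantLevel (c := fun a => levelCount s a) hQ hl₀ hzero hpos hle
  refine ⟨i, by rwa [← mul_assoc] at hi, l, hl, hdom, le_trans ?_ hlow⟩
  calc Fintype.card J / Q ^ (8 * k ^ 2 + 2 * k + 1)
      ≤ Q * levelCount s l₀ / Q ^ (8 * k ^ 2 + 2 * k + 1) := by gcongr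
    _ = levelCount s l₀ / Q ^ (8 * k ^ 2 + 2 * k) := by
        rw [pow_succ', mul_div_mul_left _ _ hQ₀.ne']
    _ = levelCount s l₀ / Q ^ ((2 * (2 * k) + 1) * (2 * k)) := by ring_nf

end DominantLevels

section GoodColourings

open Finset

variable {J R C : Type*} [Fintype J] [DecidableEq C]

/-- The colouring `g` is good for the colours `a` and `b` if both monochromatic sets have at least
half of their expected size `m` and differ from the level sets in at most `e` indices. -/
structure IsGoodColouring [DecidableEq J] (s : J → Finset R) (g : R → C) (a b : C) (l : ℕ)
    (m e : ℝ) : Prop where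
  half_le_left : m / 2 ≤ #(monoSet s g a)
  half_le_right : m / 2 ≤ #(monoSet s g b)
  deviation_left : (#(deviation s g a b l) : ℝ) ≤ e
  deviation_right : (#(deviation s g b a l) : ℝ) ≤ e

variable [Fintype R] [DecidableEq R] [Fintype C] {s : J → Finset R} {l H : ℕ} {Q m e : ℝ}

theorem card_filter_card_monoSet_lt_le (hH : ∀ t, #{j | t ∈ s j} ≤ H)
    (hm : m = levelCount s l / (Fintype.card C : ℝ) ^ l) (hmpos : 0 < m)
    (hmH : 32 * (l * H) ≤ m) (a : C) :
    (#{g : R → C | (#(monoSet s g a) : ℝ) < m / 2} : ℝ) ≤ Fintype.card (R → C) / 8 := by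
  refine le_of_mul_le_mul_right ?_ hmpos
  calc _ ≤ 4 * (l * H) * (Fintype.card (R → C) : ℝ) :=
        card_filter_card_monoSet_lt_mul_le hH a hm hmpos
    _ = 32 * (l * H) * (Fintype.card (R → C) / 8) := by ring
    _ ≤ m * (Fintype.card (R → C) / 8) := by gcongr
    _ = Fintype.card (R → C) / 8 * m := mul_comm _ _

theorem card_filter_lt_card_deviation_le [DecidableEq J]
    (hdom : DominantLevel (fun k => levelCount s k) (Fintype.card C) Q l)
    (hm : m = levelCount s l / (Fintype.card C : ℝ) ^ l) (hmpos : 0 < m) (hQ : 2 * (l + 1) ≤ Q)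
    (he : 64 * ((l + 1) / Q) * m ≤ e) (a b : C) :
    (#{g : R → C | e < #(deviation s g a b l)} : ℝ) ≤ Fintype.card (R → C) / 8 := by
  have hQ₀ : 0 < Q := lt_of_lt_of_le (by positivity) hQ
  have hepos : 0 < e := lt_of_lt_of_le (by positivity) he
  refine le_of_mul_le_mul_right ?_ hepos
  calc (#{g : R → C | e < #(deviation s g a b l)} : ℝ) * e
      ≤ ∑ g : R → C with e < #(deviation s g a b l), (#(deviation s g a b l) : ℝ) := by
        rw [← nsmul_eq_mul]
        exact card_nsmul_le_sum _ _ _ fun g hg => (mem_filter.1 hg).2.le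
    _ ≤ ∑ g : R → C, (#(deviation s g a b l) : ℝ) :=
        sum_le_sum_of_subset_of_nonneg (subset_univ _) fun _ _ _ => by positivity
    _ ≤ Fintype.card (R → C) * (8 * ((l + 1) / Q) * m) := by
        refine (sum_card_deviation_le s a b l).trans ?_
        gcongr
        rw [hm] at hmpos ⊢
        exact hdom.sum_choose_le hmpos.le hQ (notMem_erase l _)
    _ = Fintype.card (R → C) / 8 * (64 * ((l + 1) / Q) * m) := by ring
    _ ≤ Fintype.card (R → C) / 8 * e := by gcongr

open scoped Classical in
theorem half_card_le_card_filter_isGoodColouring [DecidableEq J]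
    (hdom : DominantLevel (fun k => levelCount s k) (Fintype.card C) Q l)
    (hm : m = levelCount s l / (Fintype.card C : ℝ) ^ l) (hmpos : 0 < m) (hQ : 2 * (l + 1) ≤ Q)
    (hH : ∀ t, #{j | t ∈ s j} ≤ H) (hmH : 32 * (l * H) ≤ m)
    (he : 64 * ((l + 1) / Q) * m ≤ e) (a b : C) :
    (Fintype.card (R → C) / 2 : ℝ) ≤ #{g : R → C | IsGoodColouring s g a b l m e} := by
  have hsub : (univ : Finset (R → C)) ⊆
      ({g | IsGoodColouring s g a b l m e} : Finset (R → C)) ∪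
      ((({g | (#(monoSet s g a) : ℝ) < m / 2} : Finset (R → C)) ∪
          ({g | (#(monoSet s g b) : ℝ) < m / 2} : Finset (R → C))) ∪
        (({g | e < #(deviation s g a b l)} : Finset (R → C)) ∪
          ({g | e < #(deviation s g b a l)} : Finset (R → C)))) := by
    intro g _
    simp only [mem_union, mem_filter, mem_univ, true_and]
    by_contra! hbad
    exact hbad.1 ⟨hbad.2.1.1, hbad.2.1.2, hbad.2.2.1, hbad.2.2.2⟩
  have hcard : (Fintype.card (R → C) : ℝ) ≤ #{g : R → C | IsGoodColouring s g a b l m e} +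
      ((#{g : R → C | (#(monoSet s g a) : ℝ) < m / 2} +
        #{g : R → C | (#(monoSet s g b) : ℝ) < m / 2}) +
      (#{g : R → C | e < #(deviation s g a b l)} + #{g : R → C | e < #(deviation s g b a l)})) := by
    exact_mod_cast (card_le_card hsub).trans <| (card_union_le _ _).trans <|
      Nat.add_le_add_left ((card_union_le _ _).trans <|
        Nat.add_le_add (card_union_le _ _) (card_union_le _ _)) _
  have hmono := card_filter_card_monoSet_lt_le (C := C) hH hm hmpos hmH
  have hdev := card_filter_lt_card_deviation_le hdom hm hmpos hQ he
  linarith [hmono a, hmono b, hdev a b, hdev b a]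

end GoodColourings

theorem elementDistinctness_eq_true_iff {n N : ℕ} {x : Fin n → Fin N} :
    elementDistinctness n N x = true ↔ Function.Injective x :=
  decide_eq_true_iff

namespace BranchingProgram

section Computations

variable {D ι : Type*} {n : ℕ} {P : BranchingProgram D n} {x y z : Fin n → D}

/-- The coordinate that the computation on input `x` queries at step `t`. -/
def queryAt (P : BranchingProgram D n) (x : Fin n → D) (t : Fin P.time) : Fin n :=
  P.query t (P.nodeAt x t.castSucc)

theorem nodeAt_succ (P : BranchingProgram D n) (x : Fin n → D) (t : Fin P.time) :
    P.nodeAt x t.succ = P.next t (P.nodeAt x t.castSucc) (x (P.queryAt x t)) :=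
  rfl

theorem queryAt_congr {t : Fin P.time} (h : P.nodeAt x t.castSucc = P.nodeAt y t.castSucc) :
    P.queryAt x t = P.queryAt y t := by
  rw [queryAt, queryAt, h]

theorem nodeAt_succ_congr {t : Fin P.time} (h : P.nodeAt x t.castSucc = P.nodeAt y t.castSucc)
    (hval : x (P.queryAt x t) = y (P.queryAt x t)) : P.nodeAt x t.succ = P.nodeAt y t.succ := by
  rw [nodeAt_succ, nodeAt_succ, ← queryAt_congr h, h, hval]

theorem output_congr (h : ∀ t, x (P.queryAt x t) = y (P.queryAt x t)) :
    P.output x = P.output y := by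
  have hnode (t) : P.nodeAt x t = P.nodeAt y t := by
    induction t using Fin.induction with
    | zero => rfl
    | succ t ih => exact nodeAt_succ_congr ih (h t)
  rw [output, output, hnode]

theorem exists_queryAt_eq_of_output_ne {j : Fin n} {v : D}
    (h : P.output x ≠ P.output (Function.update x j v)) : ∃ t, P.queryAt x t = j := by
  by_contra! hj
  exact h (output_congr fun t => (Function.update_of_ne (hj t) v x).symm)

/-- The computations on `x` and `y` visit the same node whenever time enters a new segment, where
`seg t` is the segment containing step `t`. -/
def SameBoundary (P : BranchingProgram D n) (seg : ℕ → ι) (x y : Fin n → D) : Prop :=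
  ∀ t : Fin P.time, seg (t + 1) ≠ seg t → P.nodeAt x t.succ = P.nodeAt y t.succ

variable {seg : ℕ → ι} {S : Set ι}

theorem SameBoundary.nodeAt_eq (hxy : P.SameBoundary seg x y)
    (h : ∀ t : Fin P.time, seg t ∈ S → P.queryAt x t = P.queryAt y t →
      x (P.queryAt x t) = y (P.queryAt x t)) (t : Fin (P.time + 1)) (ht : seg t ∈ S) :
    P.nodeAt x t = P.nodeAt y t := by
  induction t using Fin.induction with
  | zero => rfl
  | succ t ih =>
    by_cases hseg : seg (t + 1) = seg t
    · have htS : seg t ∈ S := hseg ▸ ht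
      have hnode := ih htS
      exact nodeAt_succ_congr hnode (h t htS (queryAt_congr hnode))
    · exact hxy t hseg

theorem SameBoundary.nodeAt_eq_or_nodeAt_eq (hxy : P.SameBoundary seg x y)
    (hx : ∀ t : Fin P.time, seg t ∈ S → x (P.queryAt x t) = z (P.queryAt x t))
    (hy : ∀ t : Fin P.time, seg t ∉ S → y (P.queryAt y t) = z (P.queryAt y t))
    (t : Fin (P.time + 1)) :
    (seg t ∈ S → P.nodeAt x t = P.nodeAt z t) ∧ (seg t ∉ S → P.nodeAt y t = P.nodeAt z t) := by
  induction t using Fin.induction with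
  | zero => exact ⟨fun _ => rfl, fun _ => rfl⟩
  | succ t ih =>
    rw [Fin.val_castSucc] at ih
    rw [Fin.val_succ]
    by_cases htS : seg t ∈ S
    · have hnode : P.nodeAt x t.succ = P.nodeAt z t.succ := nodeAt_succ_congr (ih.1 htS) (hx t htS)
      refine ⟨fun _ => hnode, fun hout => ?_⟩
      rw [← hnode, hxy t fun h => hout (h ▸ htS)]
    · have hnode : P.nodeAt y t.succ = P.nodeAt z t.succ := nodeAt_succ_congr (ih.2 htS) (hy t htS)
      refine ⟨fun hin => ?_, fun _ => hnode⟩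
      rw [← hnode, hxy t fun h => htS (h ▸ hin)]

theorem SameBoundary.output_eq_or_output_eq (hxy : P.SameBoundary seg x y)
    (hx : ∀ t : Fin P.time, seg t ∈ S → x (P.queryAt x t) = z (P.queryAt x t))
    (hy : ∀ t : Fin P.time, seg t ∉ S → y (P.queryAt y t) = z (P.queryAt y t)) :
    P.output z = P.output x ∨ P.output z = P.output y := by
  have h := hxy.nodeAt_eq_or_nodeAt_eq hx hy (Fin.last P.time)
  by_cases hlast : seg (Fin.last P.time : Fin (P.time + 1)) ∈ S
  · exact .inl (by rw [output, output, h.1 hlast])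
  · exact .inr (by rw [output, output, h.2 hlast])

end Computations

section Segments

open Finset

variable {D R C : Type*} [DecidableEq R] [DecidableEq C] {n : ℕ} {P : BranchingProgram D n}
  {seg : ℕ → R} {x y : Fin n → D} {g : R → C} {a b : C} {l : ℕ}

/-- The segments of time in which the computation on `x` reads the coordinate `j`. -/
def segs (P : BranchingProgram D n) (seg : ℕ → R) (x : Fin n → D) (j : Fin n) : Finset R :=
  image (fun t : Fin P.time => seg t) {t | P.queryAt x t = j}

theorem mem_segs {j : Fin n} {r : R} :
    r ∈ P.segs seg x j ↔ ∃ t : Fin P.time, P.queryAt x t = j ∧ seg t = r := by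
  simp [segs]

theorem seg_mem_segs_queryAt (seg : ℕ → R) (x : Fin n → D) (t : Fin P.time) :
    seg t ∈ P.segs seg x (P.queryAt x t) :=
  mem_segs.2 ⟨t, rfl, rfl⟩

theorem sum_card_segs_le (P : BranchingProgram D n) (seg : ℕ → R) (x : Fin n → D) :
    ∑ j, #(P.segs seg x j) ≤ P.time :=
  calc ∑ j, #(P.segs seg x j) ≤ ∑ j, #{t | P.queryAt x t = j} :=
        sum_le_sum fun _ _ => card_image_le
    _ = #(univ : Finset (Fin P.time)) :=
        (card_eq_sum_card_fiberwise fun _ _ => mem_coe.2 (mem_univ _)).symm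
    _ = P.time := card_fin _

theorem card_filter_mem_segs_le (P : BranchingProgram D n) (seg : ℕ → R) (x : Fin n → D) (r : R) :
    #{j | r ∈ P.segs seg x j} ≤ #{t : Fin P.time | seg t = r} := by
  have hsub : ({j | r ∈ P.segs seg x j} : Finset (Fin n)) ⊆
      image (P.queryAt x) {t : Fin P.time | seg t = r} := by
    intro j hj
    obtain ⟨t, htj, htr⟩ := mem_segs.1 (mem_filter.1 hj).2
    exact mem_image.2 ⟨t, mem_filter.2 ⟨mem_univ _, htr⟩, htj⟩
  exact (card_le_card hsub).trans card_image_le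

theorem eq_of_queryAt_mem_monoSet {t : Fin P.time}
    (h : P.queryAt x t ∈ monoSet (P.segs seg x) g b) : g (seg t) = b :=
  (mem_filter.1 h).2 _ (seg_mem_segs_queryAt seg x t)

theorem SameBoundary.mem_segs_iff (hxy : P.SameBoundary seg x y)
    (h : ∀ j, j ∉ monoSet (P.segs seg x) g b → j ∉ monoSet (P.segs seg y) g b → x j = y j)
    {r : R} (hr : g r ≠ b) (j : Fin n) : r ∈ P.segs seg x j ↔ r ∈ P.segs seg y j := by
  have hquery (t : Fin P.time) (ht : g (seg t) ≠ b) : P.queryAt x t = P.queryAt y t := by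
    refine queryAt_congr (hxy.nodeAt_eq (S := {r | g r ≠ b}) (fun t ht hq => ?_) t.castSucc ht)
    exact h _ (fun hmem => ht (eq_of_queryAt_mem_monoSet hmem))
      fun hmem => ht (eq_of_queryAt_mem_monoSet (hq ▸ hmem))
  simp only [mem_segs]
  refine exists_congr fun t => and_congr_left fun htr => ?_
  rw [hquery t (htr ▸ hr)]

/-- Off the segments of colour `b` the two computations coincide, which fixes both `monoSet _ g b`
and `levelSet _ g a b l`; the deviation then fixes `monoSet _ g a` as well. -/
theorem SameBoundary.monoSet_eq (hxy : P.SameBoundary seg x y) (hab : a ≠ b)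
    (hdev : deviation (P.segs seg x) g a b l = deviation (P.segs seg y) g a b l)
    (h : ∀ j, j ∉ monoSet (P.segs seg x) g b → j ∉ monoSet (P.segs seg y) g b → x j = y j) :
    monoSet (P.segs seg x) g a = monoSet (P.segs seg y) g a ∧
      monoSet (P.segs seg x) g b = monoSet (P.segs seg y) g b := by
  have hsegs (r) (hr : g r ≠ b) := hxy.mem_segs_iff h hr
  refine ⟨?_, monoSet_congr hsegs⟩
  rw [deviation, deviation, levelSet_congr hab hsegs] at hdev
  exact symmDiff_left_injective _ hdev

end Segments

section ElementDistinctness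

open Finset

variable {N n : ℕ} {P : BranchingProgram (Fin N) n} {R C : Type*} [DecidableEq R] [DecidableEq C]
  {seg : ℕ → R} {x y : Fin n → Fin N} {g : R → C} {a b : C} {l : ℕ}

theorem exists_queryAt_eq (hn : 2 ≤ n) (hP : P.Computes (elementDistinctness n N))
    (hx : Function.Injective x) (j : Fin n) : ∃ t, P.queryAt x t = j := by
  have : Nontrivial (Fin n) := Fin.nontrivial_iff_two_le.2 hn
  obtain ⟨i, hij⟩ := exists_ne j
  refine exists_queryAt_eq_of_output_ne (v := x i) fun hout => hij ?_
  have hy : Function.Injective (Function.update x j (x i)) := by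
    rwa [← elementDistinctness_eq_true_iff, ← hP, ← hout, hP, elementDistinctness_eq_true_iff]
  exact hy (by rw [Function.update_of_ne hij, Function.update_self])

theorem segs_nonempty (hn : 2 ≤ n) (hP : P.Computes (elementDistinctness n N))
    (hx : Function.Injective x) (seg : ℕ → R) (j : Fin n) : (P.segs seg x j).Nonempty := by
  obtain ⟨t, rfl⟩ := exists_queryAt_eq hn hP hx j
  exact ⟨_, seg_mem_segs_queryAt seg x t⟩

theorem disjoint_monoSet (hn : 2 ≤ n) (hP : P.Computes (elementDistinctness n N))
    (hx : Function.Injective x) (hab : a ≠ b) :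
    Disjoint (monoSet (P.segs seg x) g a) (monoSet (P.segs seg x) g b) := by
  refine disjoint_left.2 fun j hja hjb => hab ?_
  obtain ⟨t, rfl⟩ := exists_queryAt_eq hn hP hx j
  rw [← eq_of_queryAt_mem_monoSet hja, eq_of_queryAt_mem_monoSet hjb]

theorem SameBoundary.injective_piecewise (hxy : P.SameBoundary seg x y)
    (hP : P.Computes (elementDistinctness n N)) (hx : Function.Injective x)
    (hy : Function.Injective y) (hab : a ≠ b)
    (hmono : monoSet (P.segs seg x) g a = monoSet (P.segs seg y) g a)
    (h : ∀ j, j ∉ monoSet (P.segs seg x) g a → j ∉ monoSet (P.segs seg x) g b → x j = y j) :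
    Function.Injective ((monoSet (P.segs seg x) g a).piecewise x y) := by
  have hout := hxy.output_eq_or_output_eq (S := {r | g r = a})
    (z := (monoSet (P.segs seg x) g a).piecewise x y) (fun t ht => ?_) fun t ht => ?_
  · rw [← elementDistinctness_eq_true_iff] at hx hy ⊢
    rwa [hP, hP, hP, hx, hy, or_self] at hout
  · by_cases hq : P.queryAt x t ∈ monoSet (P.segs seg x) g a
    · rw [piecewise_eq_of_mem _ _ _ hq]
    · rw [piecewise_eq_of_notMem _ _ _ hq]
      exact h _ hq fun hq' => hab (ht.symm.trans (eq_of_queryAt_mem_monoSet hq'))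
  · rw [piecewise_eq_of_notMem]
    rw [hmono]
    exact fun hq => ht (eq_of_queryAt_mem_monoSet hq)

theorem card_mul_two_pow_le_of_sameBoundary (hn : 2 ≤ n)
    (hP : P.Computes (elementDistinctness n N)) (hab : a ≠ b) {f : ℕ}
    {E : Finset (Fin n → Fin N)} (hinj : ∀ x ∈ E, Function.Injective x)
    (hE : ∀ x ∈ E, ∀ y ∈ E, P.SameBoundary seg x y)
    (hdevab : ∀ x ∈ E, ∀ y ∈ E,
      deviation (P.segs seg x) g a b l = deviation (P.segs seg y) g a b l)
    (hdevba : ∀ x ∈ E, ∀ y ∈ E,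
      deviation (P.segs seg x) g b a l = deviation (P.segs seg y) g b a l)
    (hfa : ∀ x ∈ E, f ≤ #(monoSet (P.segs seg x) g a))
    (hfb : ∀ x ∈ E, f ≤ #(monoSet (P.segs seg x) g b)) :
    #E * 2 ^ f ≤ 2 * N ^ n := by
  have hcard : Fintype.card (Fin n → Fin N) = N ^ n := by simp
  rw [← hcard]
  refine card_mul_two_pow_le_of_rectangles (fun x hx y hy hFa _ hxy i hi j hj heq => ?_)
    (fun x hx y hy h => ?_) (fun x hx y hy h => ?_) hfa hfb
  · have hja := disjoint_right.1 (disjoint_monoSet hn hP (hinj x hx) hab) hj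
    have hij : i = j := by
      refine (hE x hx y hy).injective_piecewise hP (hinj x hx) (hinj y hy) hab hFa hxy ?_
      rwa [piecewise_eq_of_mem _ _ _ hi, piecewise_eq_of_notMem _ _ _ hja]
    exact hja (hij ▸ hi)
  · exact ((hE x hx y hy).monoSet_eq hab.symm (hdevba x hx y hy) h).symm
  · exact (hE x hx y hy).monoSet_eq hab (hdevab x hx y hy) h

end ElementDistinctness

end BranchingProgram

section Counting

open Finset

theorem card_le_card_mul_of_card_fiber_le {α β : Type*} [DecidableEq β] {s : Finset α}
    {t : Finset β} {f : α → β} {B : ℝ} (hf : ∀ a ∈ s, f a ∈ t)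
    (hB : ∀ b ∈ t, (#{a ∈ s | f a = b} : ℝ) ≤ B) : (#s : ℝ) ≤ #t * B := by
  rw [card_eq_sum_card_fiberwise hf, Nat.cast_sum, ← nsmul_eq_mul]
  exact sum_le_card_nsmul _ _ _ hB

theorem card_le_two_mul_of_half_card_le {α γ : Type*} [Fintype γ] [Nonempty γ] {s : Finset α}
    (r : α → γ → Prop) [∀ a c, Decidable (r a c)] {B : ℝ}
    (hhalf : ∀ a ∈ s, (Fintype.card γ / 2 : ℝ) ≤ #{c | r a c})
    (hB : ∀ c, (#{a ∈ s | r a c} : ℝ) ≤ B) : (#s : ℝ) ≤ 2 * B := by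
  have hpos : (0 : ℝ) < Fintype.card γ := Nat.cast_pos.2 Fintype.card_pos
  have hcount : #s * (Fintype.card γ / 2 : ℝ) ≤ Fintype.card γ * B :=
    calc #s * (Fintype.card γ / 2 : ℝ) ≤ ∑ a ∈ s, (#{c | r a c} : ℝ) := by
          rw [← nsmul_eq_mul]
          exact card_nsmul_le_sum _ _ _ hhalf
      _ = ∑ c, (#{a ∈ s | r a c} : ℝ) := by
          exact_mod_cast sum_card_bipartiteAbove_eq_sum_card_bipartiteBelow r (t := univ)
      _ ≤ Fintype.card γ * B := by
          rw [← nsmul_eq_mul]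
          exact sum_le_card_nsmul _ _ _ fun c _ => hB c
  exact le_of_mul_le_mul_left (by linarith) hpos

theorem card_filter_card_le_mul_rpow_le (ι : Type*) [Fintype ι] {p : ℝ} (hp₀ : 0 < p) (hp : p ≤ 1)
    (e : ℝ) : (#{S : Finset ι | (#S : ℝ) ≤ e} : ℝ) * p ^ e ≤ (p + 1) ^ Fintype.card ι :=
  calc (#{S : Finset ι | (#S : ℝ) ≤ e} : ℝ) * p ^ e
      ≤ ∑ S : Finset ι with (#S : ℝ) ≤ e, p ^ #S := by
        rw [← nsmul_eq_mul]
        refine card_nsmul_le_sum _ _ _ fun S hS => ?_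
        rw [← Real.rpow_natCast]
        exact Real.rpow_le_rpow_of_exponent_ge hp₀ hp (mem_filter.1 hS).2
    _ ≤ ∑ S : Finset ι, p ^ #S :=
        sum_le_sum_of_subset_of_nonneg (subset_univ _) fun _ _ _ => by positivity
    _ = (p + 1) ^ Fintype.card ι := by simpa using Fintype.sum_pow_mul_eq_add_pow ι p 1

theorem add_one_pow_le_two_rpow {p : ℝ} (hp : 0 ≤ p) (n : ℕ) :
    (p + 1) ^ n ≤ (2 : ℝ) ^ (2 * n * p) := by
  have hlog : 1 / 2 ≤ Real.log 2 := by linarith [Real.log_two_gt_d9]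
  calc (p + 1) ^ n ≤ Real.exp (n * p) := by
        rw [Real.exp_nat_mul]
        gcongr
        exact Real.add_one_le_exp p
    _ ≤ Real.exp (Real.log 2 * (2 * n * p)) := by
        refine Real.exp_le_exp.2 ?_
        have : (0 : ℝ) ≤ n * p := by positivity
        nlinarith
    _ = (2 : ℝ) ^ (2 * n * p) := (Real.rpow_def_of_pos two_pos _).symm

theorem card_filter_card_le_le_two_rpow (ι : Type*) [Fintype ι] (u : ℕ) (e : ℝ) :
    (#{S : Finset ι | (#S : ℝ) ≤ e} : ℝ) ≤ 2 ^ (u * e + 2 * Fintype.card ι / 2 ^ u) := by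
  have hcard := card_filter_card_le_mul_rpow_le ι (p := (2 ^ u)⁻¹) (by positivity)
    (inv_le_one_of_one_le₀ (one_le_pow₀ one_le_two)) e
  rw [Real.inv_rpow (by positivity), ← Real.rpow_natCast 2 u, ← Real.rpow_mul zero_le_two,
    Real.rpow_natCast, mul_inv_le_iff₀ (by positivity)] at hcard
  calc (#{S : Finset ι | (#S : ℝ) ≤ e} : ℝ)
      ≤ (((2 : ℝ) ^ u)⁻¹ + 1) ^ Fintype.card ι * 2 ^ (u * e) := hcard
    _ ≤ 2 ^ (2 * Fintype.card ι * ((2 : ℝ) ^ u)⁻¹) * 2 ^ (u * e) := by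
        gcongr
        exact add_one_pow_le_two_rpow (by positivity) _
    _ = 2 ^ (u * e + 2 * Fintype.card ι / 2 ^ u) := by
        rw [mul_comm, ← Real.rpow_add two_pos, ← div_eq_mul_inv]

theorem card_filter_injective (n N : ℕ) :
    #{x : Fin n → Fin N | Function.Injective x} = N.descFactorial n := by
  rw [← Fintype.card_subtype, Fintype.card_congr (Equiv.subtypeInjectiveEquivEmbedding _ _),
    Fintype.card_embedding_eq, Fintype.card_fin, Fintype.card_fin]

theorem pow_div_le_card_filter_injective {n N : ℕ} (hn : 1 ≤ n) (hN : n ^ 2 ≤ N) :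
    (N : ℝ) ^ n / n ≤ #{x : Fin n → Fin N | Function.Injective x} := by
  have hn₁ : (1 : ℝ) ≤ n := by exact_mod_cast hn
  have hN₁ : (n : ℝ) ^ 2 ≤ N := by exact_mod_cast hN
  have hN₀ : (0 : ℝ) < N := lt_of_lt_of_le (by positivity) hN₁
  have hnN : n ≤ N + 1 := by nlinarith
  have hfrac : ((n : ℝ) - 1) / N ≤ (n - 1) / n ^ 2 := by gcongr
  have hcast : ((N + 1 - n : ℕ) : ℝ) = N * (1 + -((n - 1) / N)) := by
    rw [Nat.cast_sub hnN]
    push_cast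
    field_simp
    ring
  calc (N : ℝ) ^ n / n = N ^ n * (1 + n * -((n - 1) / n ^ 2)) := by
        field_simp
        ring
    _ ≤ N ^ n * (1 + n * -((n - 1) / N)) := by gcongr
    _ ≤ N ^ n * (1 + -((n - 1) / N)) ^ n := by
        gcongr
        refine one_add_mul_le_pow ?_ n
        have : ((n : ℝ) - 1) / N ≤ 1 := (div_le_one hN₀).2 (by nlinarith)
        linarith
    _ = ((N + 1 - n : ℕ) : ℝ) ^ n := by rw [hcast, mul_pow]
    _ ≤ #{x : Fin n → Fin N | Function.Injective x} := by
        rw [card_filter_injective]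
        exact_mod_cast Nat.pow_sub_le_descFactorial N n

end Counting

namespace BranchingProgram

section BoundaryNodes

variable {D R : Type*} {n : ℕ}

/-- The possible sequences of nodes visited when time enters a new segment. -/
abbrev BoundaryNodes (P : BranchingProgram D n) (seg : ℕ → R) : Type :=
  ∀ t : {t : Fin P.time // seg (t + 1) ≠ seg t}, Fin (P.width t.1.succ)

/-- The number of possible sequences of nodes visited when time enters a new segment. -/
def boundaryStates [DecidableEq R] (P : BranchingProgram D n) (seg : ℕ → R) : ℕ :=
  Fintype.card (P.BoundaryNodes seg)

/-- The nodes that the computation on `x` visits when time enters a new segment. -/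
def boundaryNodes (P : BranchingProgram D n) (seg : ℕ → R) (x : Fin n → D) :
    P.BoundaryNodes seg :=
  fun t => P.nodeAt x t.1.succ

theorem sameBoundary_of_boundaryNodes_eq {P : BranchingProgram D n} {seg : ℕ → R} {x y : Fin n → D}
    (h : P.boundaryNodes seg x = P.boundaryNodes seg y) : P.SameBoundary seg x y :=
  fun t ht => congrFun h ⟨t, ht⟩

end BoundaryNodes

section ManyStates

open Finset

variable {N n : ℕ} {P : BranchingProgram (Fin N) n} {R C : Type*} [DecidableEq R]
  {seg : ℕ → R} {g : R → C} {a b : C} {l H k u : ℕ} {m e μ : ℝ} {E : Finset (Fin n → Fin N)}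

theorem card_le_of_isGoodColouring_of_eq [DecidableEq C] (hn : 2 ≤ n)
    (hP : P.Computes (elementDistinctness n N)) (hab : a ≠ b)
    (hinj : ∀ x ∈ E, Function.Injective x)
    (hE : ∀ x ∈ E, IsGoodColouring (P.segs seg x) g a b l m e)
    {c : P.BoundaryNodes seg × Finset (Fin n) × Finset (Fin n)}
    (hc : ∀ x ∈ E, (P.boundaryNodes seg x, deviation (P.segs seg x) g a b l,
      deviation (P.segs seg x) g b a l) = c) :
    (#E : ℝ) ≤ 2 * (N : ℝ) ^ n / 2 ^ (m / 2) := by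
  have hnodes : ∀ x ∈ E, P.boundaryNodes seg x = c.1 := fun x hx => congrArg (·.1) (hc x hx)
  have hdevab : ∀ x ∈ E, deviation (P.segs seg x) g a b l = c.2.1 := fun x hx =>
    congrArg (·.2.1) (hc x hx)
  have hdevba : ∀ x ∈ E, deviation (P.segs seg x) g b a l = c.2.2 := fun x hx =>
    congrArg (·.2.2) (hc x hx)
  have hcard : #E * 2 ^ ⌈m / 2⌉₊ ≤ 2 * N ^ n :=
    card_mul_two_pow_le_of_sameBoundary hn hP hab hinj
      (fun x hx y hy => sameBoundary_of_boundaryNodes_eq ((hnodes x hx).trans (hnodes y hy).symm))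
      (fun x hx y hy => (hdevab x hx).trans (hdevab y hy).symm)
      (fun x hx y hy => (hdevba x hx).trans (hdevba y hy).symm)
      (fun x hx => Nat.ceil_le.2 (hE x hx).half_le_left)
      (fun x hx => Nat.ceil_le.2 (hE x hx).half_le_right)
  rw [le_div_iff₀ (by positivity)]
  calc (#E : ℝ) * 2 ^ (m / 2) ≤ #E * 2 ^ ⌈m / 2⌉₊ := by
        rw [← Real.rpow_natCast]
        gcongr
        exacts [one_le_two, Nat.le_ceil _]
    _ ≤ 2 * (N : ℝ) ^ n := by exact_mod_cast hcard

theorem card_le_of_isGoodColouring [DecidableEq C] (hn : 2 ≤ n)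
    (hP : P.Computes (elementDistinctness n N)) (hab : a ≠ b)
    (hinj : ∀ x ∈ E, Function.Injective x)
    (hE : ∀ x ∈ E, IsGoodColouring (P.segs seg x) g a b l m e) (u : ℕ) :
    (#E : ℝ) ≤ P.boundaryStates seg * (2 ^ (u * e + 2 * n / 2 ^ u)) ^ 2 *
      (2 * (N : ℝ) ^ n / 2 ^ (m / 2)) := by
  let small : Finset (Finset (Fin n)) := {S | (#S : ℝ) ≤ e}
  have hsmall : (#small : ℝ) ≤ 2 ^ (u * e + 2 * n / 2 ^ u) := by
    simpa using card_filter_card_le_le_two_rpow (Fin n) u e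
  have hfiber := card_le_card_mul_of_card_fiber_le
    (t := (univ : Finset (P.BoundaryNodes seg)) ×ˢ small ×ˢ small)
    (f := fun x => (P.boundaryNodes seg x, deviation (P.segs seg x) g a b l,
      deviation (P.segs seg x) g b a l))
    (fun x hx => by simpa [small] using ⟨(hE x hx).deviation_left, (hE x hx).deviation_right⟩)
    fun c _ => card_le_of_isGoodColouring_of_eq hn hP hab (fun x hx => hinj x (mem_filter.1 hx).1)
      (fun x hx => hE x (mem_filter.1 hx).1) fun x hx => (mem_filter.1 hx).2
  refine hfiber.trans ?_
  rw [card_product, card_product, card_univ, Nat.cast_mul, Nat.cast_mul, sq]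
  gcongr
  rfl

theorem card_le_of_dominantLevel [Finite R] [Fintype C] [Nontrivial C] {Q : ℝ} {ν : ℕ} (hn : 2 ≤ n)
    (hP : P.Computes (elementDistinctness n N)) (hH : ∀ r, #{t : Fin P.time | seg t = r} ≤ H)
    (hinj : ∀ x ∈ E, Function.Injective x)
    (hdom : ∀ x ∈ E, DominantLevel (fun a => levelCount (P.segs seg x) a) (Fintype.card C) Q l)
    (hν : ∀ x ∈ E, levelCount (P.segs seg x) l = ν)
    (hm : m = ν / (Fintype.card C : ℝ) ^ l) (hmpos : 0 < m) (hQ : 2 * (l + 1) ≤ Q)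
    (hmH : 32 * (l * H) ≤ m) (he : 64 * ((l + 1) / Q) * m ≤ e) (u : ℕ) :
    (#E : ℝ) ≤ 2 * (P.boundaryStates seg * (2 ^ (u * e + 2 * n / 2 ^ u)) ^ 2 *
      (2 * (N : ℝ) ^ n / 2 ^ (m / 2))) := by
  classical
  have := Fintype.ofFinite R
  obtain ⟨a, b, hab⟩ := exists_pair_ne C
  refine card_le_two_mul_of_half_card_le
    (fun x (g : R → C) => IsGoodColouring (P.segs seg x) g a b l m e) (fun x hx => ?_) fun g => ?_
  · exact half_card_le_card_filter_isGoodColouring (hdom x hx) (by rw [hm, hν x hx]) hmpos hQ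
      (fun r => (card_filter_mem_segs_le P seg x r).trans (hH r)) hmH he a b
  · exact card_le_of_isGoodColouring hn hP hab (fun x hx => hinj x (mem_filter.1 hx).1)
      (fun x hx => (mem_filter.1 hx).2) u

theorem two_rpow_sq_mul_div_le {c w : ℝ} (hc : 0 ≤ c) (hw : w ≤ m / 16) (hμ : μ ≤ m) :
    ((2 : ℝ) ^ w) ^ 2 * (c / 2 ^ (m / 2)) ≤ c / 2 ^ (3 * μ / 8) := by
  rw [mul_div_left_comm, div_eq_mul_inv c]
  gcongr
  rw [← Real.rpow_mul_natCast zero_le_two, ← Real.rpow_sub two_pos, ← Real.rpow_neg zero_le_two]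
  refine Real.rpow_le_rpow_of_exponent_le one_le_two ?_
  push_cast
  linarith

theorem card_le_div_two_rpow [Finite R] {Q i ν : ℕ} (hn : 2 ≤ n)
    (hP : P.Computes (elementDistinctness n N)) (hH : ∀ r, #{t : Fin P.time | seg t = r} ≤ H)
    (hinj : ∀ x ∈ E, Function.Injective x) (hi : 1 ≤ i) (hl : l ∈ Icc 1 (2 * k))
    (hdom : ∀ x ∈ E, DominantLevel (fun a => levelCount (P.segs seg x) a) (Q ^ i) Q l)
    (hν : ∀ x ∈ E, levelCount (P.segs seg x) l = ν)
    (hlow : ∀ x ∈ E, μ ≤ levelCount (P.segs seg x) l / ((Q : ℝ) ^ i) ^ l)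
    (hμpos : 0 < μ) (hμH : 64 * k * H ≤ μ) (hu : u ≠ 0) (huQ : u * (192 * k) * 32 ≤ Q)
    (hμu : 2 * n / 2 ^ u ≤ μ / 32) :
    (#E : ℝ) ≤ 2 * (P.boundaryStates seg * (2 * (N : ℝ) ^ n / 2 ^ (3 * μ / 8))) := by
  obtain rfl | ⟨x₀, hx₀⟩ := E.eq_empty_or_nonempty
  · rw [card_empty, Nat.cast_zero]
    positivity
  obtain ⟨hl₁, hlk⟩ := mem_Icc.1 hl
  have hQk : 6 * k ≤ Q := by nlinarith [Nat.pos_of_ne_zero hu]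
  have : Nontrivial (Fin (Q ^ i)) := Fin.nontrivial_iff_two_le.2 <|
    (by omega : 2 ≤ Q).trans (Nat.le_self_pow (by omega) Q)
  have hcard : (Fintype.card (Fin (Q ^ i)) : ℝ) = Q ^ i := by simp
  have hlk' : (l : ℝ) ≤ 2 * k := by exact_mod_cast hlk
  have hk' : (1 : ℝ) ≤ k := by exact_mod_cast (by omega : 1 ≤ k)
  have hQk' : (6 * k : ℝ) ≤ Q := by exact_mod_cast hQk
  set m : ℝ := ν / ((Q : ℝ) ^ i) ^ l
  have hμm : μ ≤ m := by simpa only [hν x₀ hx₀] using hlow x₀ hx₀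
  have hw : u * (64 * ((l + 1) / Q) * m) + 2 * n / 2 ^ u ≤ m / 16 := by
    have hdev : u * (64 * ((l + 1) / Q)) ≤ (1 / 32 : ℝ) := by
      rw [← mul_div_assoc, ← mul_div_assoc, div_le_iff₀ (by linarith)]
      have hcast : (u * (192 * k) * 32 : ℝ) ≤ Q := by exact_mod_cast huQ
      have : u * (64 * (l + 1)) ≤ (u * (192 * k) : ℝ) :=
        mul_le_mul_of_nonneg_left (by linarith) (Nat.cast_nonneg u)
      linarith
    nlinarith
  have hclass := card_le_of_dominantLevel (C := Fin (Q ^ i)) (m := m) (Q := Q) hn hP hH hinj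
    (by rwa [hcard]) hν (by rw [hcard]) (by linarith) (by linarith)
    (by nlinarith [(Nat.cast_nonneg H : (0 : ℝ) ≤ H)]) le_rfl u
  refine hclass.trans ?_
  rw [mul_assoc]
  gcongr
  exact two_rpow_sq_mul_div_le (by positivity) hw hμm

theorem exists_dominantLevel_segs {x : Fin n → Fin N} {Q : ℝ} (hn : 2 ≤ n)
    (hP : P.Computes (elementDistinctness n N)) (hx : Function.Injective x)
    (htime : P.time ≤ k * n) (hk : 2 ≤ k) (hQk : 4 * k ≤ Q) :
    ∃ i ∈ Icc 1 (4 * k), ∃ l ∈ Icc 1 (2 * k),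
      DominantLevel (fun a => levelCount (P.segs seg x) a) (Q ^ i) Q l ∧
        n / Q ^ (10 * k ^ 2) ≤ levelCount (P.segs seg x) l / (Q ^ i) ^ l := by
  have : NeZero n := ⟨by omega⟩
  have hk' : (2 : ℝ) ≤ k := by exact_mod_cast hk
  have hQ : 1 < Q := by linarith
  obtain ⟨i, hi, l, hl, hdom, hlow⟩ := exists_dominantLevel_levelCount
    (segs_nonempty hn hP hx seg) (by simpa using (P.sum_card_segs_le seg x).trans htime) hQk hQ
  refine ⟨i, hi, l, hl, hdom, le_trans ?_ hlow⟩
  have hexp : 8 * k ^ 2 + 2 * k + 1 ≤ 10 * k ^ 2 := by nlinarith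
  rw [Fintype.card_fin]
  gcongr
  exact hQ.le

theorem two_mul_div_two_pow_le {Q d : ℕ} (hQ : 0 < (Q : ℝ)) (hμ : μ = n / (Q : ℝ) ^ d)
    (hQu : 64 * Q ^ d ≤ 2 ^ u) : 2 * n / 2 ^ u ≤ μ / 32 :=
  calc (2 * n / 2 ^ u : ℝ) ≤ 2 * n / (64 * Q ^ d) := by
        gcongr
        exact_mod_cast hQu
    _ = μ / 32 := by
        rw [hμ]
        field_simp
        ring

theorem card_filter_injective_le [Finite R] {Q : ℕ} (hn : 2 ≤ n)
    (hP : P.Computes (elementDistinctness n N)) (hH : ∀ r, #{t : Fin P.time | seg t = r} ≤ H)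
    (htime : P.time ≤ k * n) (hk : 2 ≤ k) (hμ : μ = n / (Q : ℝ) ^ (10 * k ^ 2))
    (hμH : 64 * k * H ≤ μ) (hu : u ≠ 0) (huQ : u * (192 * k) * 32 ≤ Q)
    (hQu : 64 * Q ^ (10 * k ^ 2) ≤ 2 ^ u) :
    (#{x : Fin n → Fin N | Function.Injective x} : ℝ) ≤ 4 * k * (2 * k * (n + 1)) *
      (2 * (P.boundaryStates seg * (2 * (N : ℝ) ^ n / 2 ^ (3 * μ / 8)))) := by
  have hQk : 4 * k ≤ Q := by nlinarith [Nat.pos_of_ne_zero hu]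
  have hQ : (0 : ℝ) < Q := by exact_mod_cast (by omega : 0 < Q)
  have hμpos : 0 < μ := by
    have : (0 : ℝ) < n := by exact_mod_cast (by omega : 0 < n)
    rw [hμ]
    positivity
  have hsel (x : Fin n → Fin N) (hx : Function.Injective x) :=
    exists_dominantLevel_segs (seg := seg) (Q := Q) hn hP hx htime hk (by exact_mod_cast hQk)
  choose! i hi l hl hdom hlow using hsel
  have hfiber := card_le_card_mul_of_card_fiber_le
    (s := ({x | Function.Injective x} : Finset (Fin n → Fin N)))
    (t := Icc 1 (4 * k) ×ˢ Icc 1 (2 * k) ×ˢ range (n + 1))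
    (f := fun x => (i x, l x, levelCount (P.segs seg x) (l x)))
    (B := 2 * (P.boundaryStates seg * (2 * (N : ℝ) ^ n / 2 ^ (3 * μ / 8))))
    (fun x hx => ?_) fun c hc => ?_
  · simpa using hfiber
  · have hx : Function.Injective x := (mem_filter.1 hx).2
    simp only [mem_product, hi x hx, hl x hx, mem_range_succ_iff, true_and]
    simpa [levelCount] using card_le_univ ({j | _} : Finset (Fin n))
  · obtain ⟨hi', hl', -⟩ := by simpa only [mem_product] using hc
    have hmem : ∀ x ∈ filter (fun x => (i x, l x, levelCount (P.segs seg x) (l x)) = c)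
        {x | Function.Injective x}, Function.Injective x ∧ i x = c.1 ∧ l x = c.2.1 ∧
          levelCount (P.segs seg x) (l x) = c.2.2 := fun x hx => by
      obtain ⟨hinj, rfl⟩ := mem_filter.1 hx
      exact ⟨(mem_filter.1 hinj).2, rfl, rfl, rfl⟩
    refine card_le_div_two_rpow (i := c.1) (ν := c.2.2) hn hP hH (fun x hx => (hmem x hx).1)
      (mem_Icc.1 hi').1 hl' (fun x hx => ?_) (fun x hx => ?_) (fun x hx => ?_) hμpos hμH hu huQ
      (two_mul_div_two_pow_le hQ hμ hQu)
      <;> obtain ⟨hinj, hix, hlx, hνx⟩ := hmem x hx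
    · simpa only [hix, hlx] using hdom x hinj
    · simpa only [hlx] using hνx
    · simpa only [hix, hlx, ← hμ] using hlow x hinj

theorem two_rpow_le_boundaryStates [Finite R] {Q : ℕ} (hn : 2 ≤ n) (hN : n ^ 2 ≤ N)
    (hP : P.Computes (elementDistinctness n N)) (hH : ∀ r, #{t : Fin P.time | seg t = r} ≤ H)
    (htime : P.time ≤ k * n) (hk : 2 ≤ k) (hμ : μ = n / (Q : ℝ) ^ (10 * k ^ 2))
    (hμH : 64 * k * H ≤ μ) (hu : u ≠ 0) (huQ : u * (192 * k) * 32 ≤ Q)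
    (hQu : 64 * Q ^ (10 * k ^ 2) ≤ 2 ^ u) (hbig : 64 * (k : ℝ) ^ 2 * n ^ 2 ≤ 2 ^ (μ / 8)) :
    (2 : ℝ) ^ (μ / 4) ≤ P.boundaryStates seg := by
  have hn₁ : (1 : ℝ) ≤ n := by exact_mod_cast (by omega : 1 ≤ n)
  have hN₀ : (0 : ℝ) < N := by exact_mod_cast (by nlinarith : 0 < N)
  have hcount := (pow_div_le_card_filter_injective (by omega) hN).trans
    (card_filter_injective_le hn hP hH htime hk hμ hμH hu huQ hQu)
  rw [div_le_iff₀ (by positivity)] at hcount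
  refine le_of_mul_le_mul_left ?_ (by positivity : (0 : ℝ) < N ^ n * 2 ^ (μ / 8))
  calc (N : ℝ) ^ n * 2 ^ (μ / 8) * 2 ^ (μ / 4) = N ^ n * 2 ^ (3 * μ / 8) := by
        rw [mul_assoc, ← Real.rpow_add two_pos]
        ring_nf
    _ ≤ 4 * k * (2 * k * (n + 1)) *
          (2 * (P.boundaryStates seg * (2 * (N : ℝ) ^ n / 2 ^ (3 * μ / 8)))) * n *
          2 ^ (3 * μ / 8) := by gcongr
    _ = N ^ n * (32 * k ^ 2 * n * (n + 1)) * P.boundaryStates seg := by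
        field_simp
        ring
    _ ≤ N ^ n * (64 * k ^ 2 * n ^ 2) * P.boundaryStates seg := by
        gcongr ?_ * ?_ * ?_
        nlinarith [(by positivity : (0 : ℝ) ≤ k ^ 2 * n)]
    _ ≤ N ^ n * 2 ^ (μ / 8) * P.boundaryStates seg := by gcongr

end ManyStates

end BranchingProgram

namespace BranchingProgram

section Averaging

open Finset

variable {D R : Type*} {n : ℕ} {τ h c : ℕ}

/-- The segment of time `t`, when time is cut into segments of length `h`, with offset `c`. For
`t ≤ τ` and `c < h` the quotient is at most `τ + h`, so that `Fin.ofNat` does not wrap around. -/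
def segment (τ h c t : ℕ) : Fin (τ + h + 1) := Fin.ofNat (τ + h + 1) ((t + c) / h)

theorem dvd_of_segment_ne {t : ℕ} (hne : segment τ h c (t + 1) ≠ segment τ h c t) :
    h ∣ t + 1 + c := by
  contrapose! hne
  rw [add_right_comm t] at hne
  rw [segment, segment, add_right_comm t, Nat.succ_div_of_not_dvd hne]

theorem card_filter_segment_ne_le_one (τ h t : ℕ) :
    #{c ∈ range h | segment τ h c (t + 1) ≠ segment τ h c t} ≤ 1 := by
  refine card_le_one.2 fun c hc c' hc' => ?_
  obtain ⟨hch, hne⟩ := mem_filter.1 hc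
  obtain ⟨hch', hne'⟩ := mem_filter.1 hc'
  have hmod : t + 1 + c ≡ t + 1 + c' [MOD h] :=
    (Nat.modEq_zero_iff_dvd.2 (dvd_of_segment_ne hne)).trans
      (Nat.modEq_zero_iff_dvd.2 (dvd_of_segment_ne hne')).symm
  exact (Nat.ModEq.add_left_cancel' _ hmod).eq_of_lt_of_lt (mem_range.1 hch) (mem_range.1 hch')

theorem val_segment (hc : c < h) (t : Fin τ) : (segment τ h c t : ℕ) = (t + c) / h := by
  rw [segment, Fin.val_ofNat, Nat.mod_eq_of_lt]
  have := Nat.div_le_self (t + c) h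
  omega

theorem card_filter_segment_eq_le (hc : c < h) (r : Fin (τ + h + 1)) :
    #{t : Fin τ | segment τ h c t = r} ≤ h := by
  have hmaps : ∀ t ∈ ({t : Fin τ | segment τ h c t = r} : Finset (Fin τ)),
      (t + c) % h ∈ range h := fun t _ => mem_range.2 (Nat.mod_lt _ (by omega))
  refine (card_le_card_of_injOn _ hmaps fun t ht t' ht' hmod => ?_).trans_eq (card_range h)
  have hdiv : (t + c) / h = (t' + c) / h := by
    rw [← val_segment hc, ← val_segment hc, (mem_filter.1 ht).2, (mem_filter.1 ht').2]
  have hadd : (t : ℕ) + c = t' + c := by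
    rw [← Nat.div_add_mod (t + c) h, ← Nat.div_add_mod (t' + c) h, hdiv, hmod]
  exact Fin.ext (Nat.add_right_cancel hadd)

variable [Nonempty D] (P : BranchingProgram D n)

theorem width_pos (t : Fin (P.time + 1)) : 0 < P.width t :=
  Fin.pos (P.nodeAt (fun _ => Classical.arbitrary D) t)

theorem logb_width_nonneg (t : Fin (P.time + 1)) : 0 ≤ Real.logb 2 (P.width t) :=
  Real.logb_nonneg one_lt_two (by exact_mod_cast P.width_pos t)

theorem logb_boundaryStates [DecidableEq R] (seg : ℕ → R) :
    Real.logb 2 (P.boundaryStates seg) =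
      ∑ t ∈ univ.filter fun t : Fin P.time => seg (t + 1) ≠ seg t,
        Real.logb 2 (P.width t.succ) := by
  rw [boundaryStates, Fintype.card_pi, Nat.cast_prod, Real.logb_prod]
  · simp only [Fintype.card_fin]
    rw [sum_subtype (p := fun t : Fin P.time => seg (t + 1) ≠ seg t) _ (by simp)]
  · intro t _
    simpa using (P.width_pos t.1.succ).ne'

theorem sum_logb_boundaryStates_le (h : ℕ) :
    ∑ c ∈ range h, Real.logb 2 (P.boundaryStates (segment P.time h c)) ≤ P.cumulativeMemory := by
  simp only [logb_boundaryStates, sum_filter]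
  rw [sum_comm, cumulativeMemory, Fin.sum_univ_succ]
  refine le_add_of_nonneg_of_le (P.logb_width_nonneg 0) (sum_le_sum fun t _ => ?_)
  rw [← sum_filter, sum_const, nsmul_eq_mul]
  refine mul_le_of_le_one_left (P.logb_width_nonneg _) ?_
  exact_mod_cast card_filter_segment_ne_le_one P.time h t

theorem mul_le_cumulativeMemory {b : ℝ}
    (hb : ∀ c < h, (2 : ℝ) ^ b ≤ P.boundaryStates (segment P.time h c)) :
    h * b ≤ P.cumulativeMemory :=
  calc h * b = ∑ _c ∈ range h, b := by rw [sum_const, card_range, nsmul_eq_mul]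
    _ ≤ ∑ c ∈ range h, Real.logb 2 (P.boundaryStates (segment P.time h c)) := by
        refine sum_le_sum fun c hc => ?_
        have hc := hb c (mem_range.1 hc)
        rwa [Real.le_logb_iff_rpow_le one_lt_two (hc.trans_lt' (by positivity))]
    _ ≤ P.cumulativeMemory := P.sum_logb_boundaryStates_le h

end Averaging

theorem sq_div_pow_le_floor_mul {m μ q : ℝ} {k : ℕ} (hk : k ≠ 0) (hkq : 512 * k ≤ q)
    (hμ : μ = m / q ^ (10 * k ^ 2)) (hμk : 64 * k ≤ μ) :
    m ^ 2 / q ^ (21 * k ^ 2) ≤ ⌊μ / (64 * k)⌋₊ * (μ / 4) := by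
  have hk₁ : (1 : ℝ) ≤ k := by exact_mod_cast Nat.pos_of_ne_zero hk
  have hq : 1 ≤ q := by linarith
  have hfloor : μ / (64 * k) / 2 ≤ ⌊μ / (64 * k)⌋₊ :=
    (Nat.div_two_lt_floor <| (one_le_div₀ (by positivity)).2 hμk).le
  calc m ^ 2 / q ^ (21 * k ^ 2) = m ^ 2 / (q ^ k ^ 2 * (q ^ (10 * k ^ 2)) ^ 2) := by
        congr 1
        ring
    _ ≤ m ^ 2 / (512 * k * (q ^ (10 * k ^ 2)) ^ 2) := by
        gcongr
        exact hkq.trans (le_self_pow₀ hq (by positivity))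
    _ = μ / (64 * k) / 2 * (μ / 4) := by
        rw [hμ]
        field_simp
        ring
    _ ≤ ⌊μ / (64 * k)⌋₊ * (μ / 4) := by
        have : 0 ≤ μ := by linarith
        gcongr

section LowerBound

variable {N n k u Q : ℕ} {P : BranchingProgram (Fin N) n} {μ : ℝ}

theorem le_time (hn : 2 ≤ n) (hN : n ≤ N) (hP : P.Computes (elementDistinctness n N)) :
    n ≤ P.time := by
  have hsurj : Function.Surjective (P.queryAt (Fin.castLE hN)) :=
    exists_queryAt_eq hn hP (Fin.castLE_injective hN)
  simpa using Fintype.card_le_of_surjective _ hsurj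

theorem floor_mul_le_cumulativeMemory (hn : 2 ≤ n) (hN : n ^ 2 ≤ N)
    (hP : P.Computes (elementDistinctness n N)) (htime : P.time ≤ k * n) (hk : 2 ≤ k)
    (hμ : μ = n / (Q : ℝ) ^ (10 * k ^ 2)) (hu : u ≠ 0) (huQ : u * (192 * k) * 32 ≤ Q)
    (hQu : 64 * Q ^ (10 * k ^ 2) ≤ 2 ^ u) (hbig : 64 * (k : ℝ) ^ 2 * n ^ 2 ≤ 2 ^ (μ / 8)) :
    ⌊μ / (64 * k)⌋₊ * (μ / 4) ≤ P.cumulativeMemory := by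
  have : NeZero N := ⟨by nlinarith⟩
  have hμ₀ : 0 ≤ μ := by rw [hμ]; positivity
  have : (0 : ℝ) < k := by exact_mod_cast (by omega : 0 < k)
  have hfloor : 64 * k * ⌊μ / (64 * k)⌋₊ ≤ μ := by
    rw [← le_div_iff₀' (by positivity)]
    exact Nat.floor_le (by positivity)
  exact P.mul_le_cumulativeMemory fun c hc => two_rpow_le_boundaryStates hn hN hP
    (card_filter_segment_eq_le hc) htime hk hμ hfloor hu huQ hQu hbig

theorem sq_div_pow_le_cumulativeMemory (hn : 2 ≤ n) (hN : n ^ 2 ≤ N)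
    (hP : P.Computes (elementDistinctness n N)) (htime : P.time ≤ k * n) (hk : 2 ≤ k)
    (hu : u ≠ 0) (huQ : u * (192 * k) * 32 ≤ Q) (hQu : 64 * Q ^ (10 * k ^ 2) ≤ 2 ^ u)
    (hsmall : (Q : ℝ) ^ (21 * k ^ 2) ≤ √n) (hlarge : 64 * (n : ℝ) ^ 3 ≤ 2 ^ (√n / 8)) :
    (n : ℝ) ^ 2 / (Q : ℝ) ^ (21 * k ^ 2) ≤ P.cumulativeMemory := by
  have hkQ : (512 * k : ℝ) ≤ Q := by exact_mod_cast (by nlinarith [Nat.pos_of_ne_zero hu])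
  have hk₂ : (2 : ℝ) ≤ k := by exact_mod_cast hk
  have hQ₁ : (1 : ℝ) ≤ Q := by linarith
  have hsqrt : √(n : ℝ) ^ 2 = n := Real.sq_sqrt (Nat.cast_nonneg n)
  have hksqrt : 64 * (k : ℝ) ≤ √n := by
    linarith [le_self_pow₀ hQ₁ (by positivity : 21 * k ^ 2 ≠ 0)]
  have hμ : √(n : ℝ) ≤ n / (Q : ℝ) ^ (10 * k ^ 2) := by
    have hpow : (Q : ℝ) ^ (10 * k ^ 2) ≤ √n :=
      (pow_le_pow_right₀ hQ₁ (Nat.mul_le_mul_right _ (by norm_num))).trans hsmall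
    rw [le_div_iff₀ (by positivity)]
    nlinarith
  have hbig : 64 * (k : ℝ) ^ 2 * n ^ 2 ≤ 2 ^ (n / (Q : ℝ) ^ (10 * k ^ 2) / 8) :=
    calc 64 * (k : ℝ) ^ 2 * n ^ 2 ≤ 64 * n * n ^ 2 := by
          gcongr
          nlinarith
      _ = 64 * (n : ℝ) ^ 3 := by ring
      _ ≤ 2 ^ (√n / 8) := hlarge
      _ ≤ 2 ^ (n / (Q : ℝ) ^ (10 * k ^ 2) / 8) := by
          gcongr
          exact one_le_two
  exact (sq_div_pow_le_floor_mul (by omega) hkQ rfl (hksqrt.trans hμ)).trans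
    (floor_mul_le_cumulativeMemory hn hN hP htime hk rfl hu huQ hQu hbig)

end LowerBound

end BranchingProgram

theorem mul_mul_le_two_pow {k κ : ℕ} (hκ : 1 ≤ κ) (hkκ : k ≤ 2 ^ κ) :
    (320 * κ * k ^ 2 + 6) * (192 * k) * 32 ≤ 2 ^ (32 * κ) := by
  have hp : 2 ≤ 2 ^ κ := Nat.le_self_pow (by omega) 2
  have hu : 320 * κ * k ^ 2 + 6 ≤ 326 * (2 ^ κ) ^ 3 :=
    calc 320 * κ * k ^ 2 + 6 ≤ 320 * 2 ^ κ * (2 ^ κ) ^ 2 + 6 * (2 ^ κ) ^ 3 := by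
          gcongr
          · exact Nat.lt_two_pow_self.le
          · exact Nat.le_mul_of_pos_right 6 (by positivity)
      _ = 326 * (2 ^ κ) ^ 3 := by ring
  calc (320 * κ * k ^ 2 + 6) * (192 * k) * 32
      ≤ 326 * (2 ^ κ) ^ 3 * (192 * 2 ^ κ) * 32 := by gcongr
    _ = 2002944 * (2 ^ κ) ^ 4 := by ring
    _ ≤ 2 ^ 28 * (2 ^ κ) ^ 4 := by gcongr; norm_num
    _ ≤ (2 ^ κ) ^ 28 * (2 ^ κ) ^ 4 := by gcongr
    _ = 2 ^ (32 * κ) := by ring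

theorem exists_nat_two_pow_le_max_pow {ρ : ℝ} (hρ : 1 ≤ ρ) :
    ∃ k κ : ℕ, 2 ≤ k ∧ 1 ≤ κ ∧ k ≤ 2 ^ κ ∧ ρ ≤ k ∧ k ≤ 2 * ρ ∧ (2 : ℝ) ^ κ ≤ max ρ 2 ^ 3 := by
  have hM : 2 ≤ max ρ 2 := le_max_right _ _
  have hk : 2 ≤ max 2 ⌈ρ⌉₊ := le_max_left _ _
  have hkρ : (max 2 ⌈ρ⌉₊ : ℕ) ≤ 2 * ρ := by
    rw [Nat.cast_max]
    exact max_le (by push_cast; linarith) (by linarith [Nat.ceil_lt_add_one (by linarith : 0 ≤ ρ)])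
  refine ⟨max 2 ⌈ρ⌉₊, Nat.clog 2 (max 2 ⌈ρ⌉₊), hk, Nat.clog_pos one_lt_two hk,
    Nat.le_pow_clog one_lt_two _, (Nat.le_ceil ρ).trans (by exact_mod_cast le_max_right _ _), hkρ,
    ?_⟩
  have hpow : 2 ^ Nat.clog 2 (max 2 ⌈ρ⌉₊) ≤ 2 * max 2 ⌈ρ⌉₊ := by
    rw [← Nat.sub_add_cancel (Nat.clog_pos one_lt_two hk), pow_succ']
    exact Nat.mul_le_mul_left 2 (Nat.pow_pred_clog_lt_self one_lt_two (by omega)).le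
  calc (2 : ℝ) ^ Nat.clog 2 (max 2 ⌈ρ⌉₊) ≤ 2 * (max 2 ⌈ρ⌉₊ : ℕ) := by exact_mod_cast hpow
    _ ≤ 2 * 2 * max ρ 2 := by linarith [le_max_left ρ 2]
    _ ≤ max ρ 2 * max ρ 2 * max ρ 2 := by gcongr
    _ = max ρ 2 ^ 3 := by ring

theorem two_pow_pow_le_rpow {ρ M : ℝ} {k κ : ℕ} (hM : 1 ≤ M) (hkρ : k ≤ 2 * ρ)
    (hκM : (2 : ℝ) ^ κ ≤ M ^ 3) :
    ((2 : ℝ) ^ (32 * κ)) ^ (21 * k ^ 2) ≤ M ^ (8064 * ρ ^ 2) :=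
  calc ((2 : ℝ) ^ (32 * κ)) ^ (21 * k ^ 2) = ((2 : ℝ) ^ κ) ^ (672 * k ^ 2) := by ring
    _ ≤ (M ^ 3) ^ (672 * k ^ 2) := by gcongr
    _ = M ^ ((2016 * k ^ 2 : ℕ) : ℝ) := by
        rw [Real.rpow_natCast, ← pow_mul]
        ring
    _ ≤ M ^ (8064 * ρ ^ 2) := by
        refine Real.rpow_le_rpow_of_exponent_le hM ?_
        push_cast
        nlinarith [(Nat.cast_nonneg k : (0 : ℝ) ≤ k)]

theorem BranchingProgram.edBound_le_cumulativeMemory {N n : ℕ} {P : BranchingProgram (Fin N) n}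
    (hn : 2 ≤ n) (hN : n ^ 2 ≤ N) (hP : P.Computes (elementDistinctness n N))
    (hsmall : max ((P.time : ℝ) / n) 2 ^ (8064 * ((P.time : ℝ) ^ 2 / (n : ℝ) ^ 2)) ≤ √n)
    (hlarge : 64 * (n : ℝ) ^ 3 ≤ 2 ^ (√n / 8)) :
    edBound 8064 n P.time ≤ P.cumulativeMemory := by
  have hn₀ : (0 : ℝ) < n := by exact_mod_cast (by omega : 0 < n)
  have hρ : (1 : ℝ) ≤ P.time / n := by
    rw [one_le_div₀ hn₀]
    exact_mod_cast le_time hn ((Nat.le_self_pow two_ne_zero n).trans hN) hP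
  obtain ⟨k, κ, hk, hκ, hkκ, hρk, hkρ, hκM⟩ := exists_nat_two_pow_le_max_pow hρ
  have htime : P.time ≤ k * n := by exact_mod_cast (div_le_iff₀ hn₀).1 hρk
  have hpow := two_pow_pow_le_rpow (one_le_two.trans (le_max_right _ 2)) hkρ hκM
  rw [div_pow] at hpow
  have hbound := sq_div_pow_le_cumulativeMemory (Q := 2 ^ (32 * κ)) (u := 320 * κ * k ^ 2 + 6) hn hN
    hP htime hk (Nat.succ_ne_zero _) (mul_mul_le_two_pow hκ hkκ) (le_of_eq (by ring))
    (by exact_mod_cast hpow.trans hsmall) hlarge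
  refine le_trans ?_ hbound
  rw [edBound]
  push_cast
  gcongr

/-- The exponent `ε` such that `edBound C n τ = n ^ (2 - ε)`. -/
noncomputable def edExponent (C : ℝ) (n τ : ℕ) : ℝ :=
  C * ((τ : ℝ) ^ 2 / (n : ℝ) ^ 2) * Real.log (max ((τ : ℝ) / n) 2) / Real.log n

theorem max_rpow_eq_rpow_edExponent (C : ℝ) {n : ℕ} (hn : 1 < n) (τ : ℕ) :
    max ((τ : ℝ) / n) 2 ^ (C * ((τ : ℝ) ^ 2 / (n : ℝ) ^ 2)) = (n : ℝ) ^ edExponent C n τ := by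
  have hn₁ : (1 : ℝ) < n := by exact_mod_cast hn
  rw [Real.rpow_def_of_pos (two_pos.trans_le (le_max_right _ _)),
    Real.rpow_def_of_pos (by linarith), edExponent, mul_div_cancel₀ _ (Real.log_pos hn₁).ne',
    mul_comm]

theorem edBound_eq_rpow_edExponent (C : ℝ) {n : ℕ} (hn : 1 < n) (τ : ℕ) :
    edBound C n τ = (n : ℝ) ^ (2 - edExponent C n τ) := by
  rw [edBound, max_rpow_eq_rpow_edExponent C hn, Real.rpow_sub (by positivity), Real.rpow_two]

theorem edExponent_mono {C : ℝ} (hC : 0 ≤ C) {n τ τ' : ℕ} (h : τ ≤ τ') :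
    edExponent C n τ ≤ edExponent C n τ' := by
  have hlog : 0 ≤ Real.log (max ((τ : ℝ) / n) 2) :=
    Real.log_nonneg (one_le_two.trans (le_max_right _ _))
  rw [edExponent, edExponent]
  gcongr

section Asymptotics

open Filter Topology

theorem eventually_mul_cube_le_two_rpow_sqrt :
    ∀ᶠ n : ℕ in atTop, 64 * (n : ℝ) ^ 3 ≤ 2 ^ (√n / 8) := by
  have hexp : Tendsto (fun y : ℝ => Real.exp (Real.log 2 / 8 * y) / y ^ (6 : ℝ)) atTop atTop :=
    tendsto_exp_mul_div_rpow_atTop 6 _ (by positivity)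
  have hsqrt : Tendsto (fun n : ℕ => √(n : ℝ)) atTop atTop :=
    Real.tendsto_sqrt_atTop.comp tendsto_natCast_atTop_atTop
  filter_upwards [(hexp.comp hsqrt).eventually_ge_atTop 64, eventually_gt_atTop 0] with n hn hn₀
  have : 0 < √(n : ℝ) := Real.sqrt_pos.2 (by exact_mod_cast hn₀)
  have hpow : √(n : ℝ) ^ (6 : ℝ) = n ^ 3 := by
    rw [Real.sqrt_eq_rpow, ← Real.rpow_mul (Nat.cast_nonneg n)]
    norm_num
  rw [Function.comp_apply, le_div_iff₀ (by positivity), hpow] at hn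
  rwa [Real.rpow_def_of_pos two_pos, mul_div_assoc', ← div_mul_eq_mul_div]

theorem sq_div_mul_log_max_div_le {m τ L : ℝ} (hm : 0 < m) (hL : 2 ≤ L) (hlogL : 1 ≤ Real.log L)
    (hτ : τ ≤ m * √(L / Real.log L)) :
    τ ^ 2 / m ^ 2 * Real.log (max (τ / m) 2) / L ≤ (τ / (m * √(L / Real.log L))) ^ 2 := by
  have hsqrt : √(L / Real.log L) ≤ L := by
    rw [Real.sqrt_le_left (by linarith), div_le_iff₀ (by linarith)]
    nlinarith [mul_nonneg (sq_nonneg L) (sub_nonneg.2 hlogL)]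
  have hmax : max (τ / m) 2 ≤ L :=
    max_le (((div_le_iff₀' hm).2 hτ).trans hsqrt) hL
  calc τ ^ 2 / m ^ 2 * Real.log (max (τ / m) 2) / L ≤ τ ^ 2 / m ^ 2 * Real.log L / L := by
        gcongr
    _ = (τ / (m * √(L / Real.log L))) ^ 2 := by
        rw [div_pow, mul_pow, Real.sq_sqrt (by positivity)]
        field_simp

theorem tendsto_edExponent {T : ℕ → ℕ} {C : ℝ} (hC : 0 ≤ C)
    (hT : Asymptotics.IsLittleO atTop (fun n : ℕ => (T n : ℝ))
      (fun n : ℕ => (n : ℝ) * √(Real.log n / Real.log (Real.log n)))) :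
    Tendsto (fun n => edExponent C n (T n)) atTop (𝓝 0) := by
  have hratio := hT.tendsto_div_nhds_zero
  have hlog : Tendsto (fun n : ℕ => Real.log n) atTop atTop :=
    Real.tendsto_log_atTop.comp tendsto_natCast_atTop_atTop
  have hloglog : Tendsto (fun n : ℕ => Real.log (Real.log n)) atTop atTop :=
    Real.tendsto_log_atTop.comp hlog
  refine squeeze_zero' (.of_forall fun n => ?_) ?_ (by simpa using (hratio.pow 2).const_mul C)
  · simpa [edExponent] using edExponent_mono hC (n := n) (Nat.zero_le (T n))
  filter_upwards [hlog.eventually_ge_atTop 2, hloglog.eventually_ge_atTop 1,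
    hratio.eventually_le_const zero_lt_one, eventually_gt_atTop 0] with n hL hlogL hle hn
  have hn₀ : (0 : ℝ) < n := by exact_mod_cast hn
  rw [div_le_one (by positivity)] at hle
  rw [edExponent, mul_assoc, mul_div_assoc]
  gcongr
  exact sq_div_mul_log_max_div_le hn₀ hL hlogL hle

theorem mainTheorem10_general :
    ∃ C : ℝ, 0 < C ∧ ∀ T : ℕ → ℕ,
      Asymptotics.IsLittleO Filter.atTop (fun n : ℕ => (T n : ℝ))
        (fun n : ℕ => (n : ℝ) * Real.sqrt (Real.log n / Real.log (Real.log n))) →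
      ∃ δ : ℕ → ℝ, Filter.Tendsto δ Filter.atTop (nhds 0) ∧
        ∀ᶠ n : ℕ in Filter.atTop, ∀ N ≥ n ^ 2, ∀ P : BranchingProgram (Fin N) n,
          P.time ≤ T n → P.Computes (elementDistinctness n N) →
            edBound C n P.time ≤ P.cumulativeMemory ∧
            (n : ℝ) ^ (2 - δ n) ≤ edBound C n P.time := by
  refine ⟨8064, by norm_num, fun T hT => ?_⟩
  have hδ := tendsto_edExponent (C := 8064) (by norm_num) hT
  refine ⟨_, hδ, ?_⟩
  filter_upwards [hδ.eventually_le_const one_half_pos, eventually_mul_cube_le_two_rpow_sqrt,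
    eventually_ge_atTop 2] with n hhalf hlarge hn N hN P htime hP
  have hn₁ : (1 : ℝ) ≤ n := by exact_mod_cast (by omega : 1 ≤ n)
  have hexp : edExponent 8064 n P.time ≤ edExponent 8064 n (T n) :=
    edExponent_mono (by norm_num) htime
  constructor
  · refine BranchingProgram.edBound_le_cumulativeMemory hn hN hP ?_ hlarge
    rw [max_rpow_eq_rpow_edExponent _ hn, Real.sqrt_eq_rpow]
    exact Real.rpow_le_rpow_of_exponent_le hn₁ (hexp.trans hhalf)
  · rw [edBound_eq_rpow_edExponent _ hn]
    exact Real.rpow_le_rpow_of_exponent_le hn₁ (by linarith)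

end Asymptotics

theorem mainTheorem10 :
    ∃ C : ℝ, 0 < C ∧ ∀ T : ℕ → ℕ,
      Asymptotics.IsLittleO Filter.atTop (fun n : ℕ => (T n : ℝ))
        (fun n : ℕ => (n : ℝ) * Real.sqrt (Real.log n / Real.log (Real.log n))) →
      ∃ δ : ℕ → ℝ, Filter.Tendsto δ Filter.atTop (nhds 0) ∧
        ∀ᶠ n : ℕ in Filter.atTop, ∀ P : BranchingProgram (Fin (n ^ 2)) n,
          P.time ≤ T n → P.Computes (elementDistinctness n (n ^ 2)) →
            edBound C n P.time ≤ P.cumulativeMemory ∧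
            (n : ℝ) ^ (2 - δ n) ≤ edBound C n P.time := by
  obtain ⟨C, hC, h⟩ := mainTheorem10_general
  exact ⟨C, hC, fun T hT => (h T hT).imp fun _ hδ => ⟨hδ.1, hδ.2.mono fun n hn => hn _ le_rfl⟩⟩
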